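/- Let $n$ objects with true scores $\beta^*\in\mathbb{R}^n$, $\sum_i\beta^*_i=0$, be compared in pairs by subjects $s=1,2,\dots$, and let $\sigma(t)=1/(1+e^{-t})$. Let $W^{(s)}_{ij}$ be the number of times subject $s$ prefers $i$ to $j$ (with $W^{(s)}_{ii}=0$), let $\mathbf V^{(s)}=\mathbf W^{(s)}+(\mathbf W^{(s)})^\top$ be the comparison matrix of subject $s$, and let $V^{(s)}=\sum_{i<j}V^{(s)}_{ij}$ be the number of comparisons made by $s$. Assume: - the subjects are independent, i.e. the random matrices $\mathbf W^{(1)},\mathbf W^{(2)},\dots$ are independent; - the $V^{(s)}$ are identically distributed with $0<\mathbb{E}[V^{(s)}]<\infty$ and $\mathrm{Var}[V^{(s)}]<\infty$; - there is a matrix $\mathbf P\in[0,1]^{n\times n}$ with $\mathbb{E}[\mathbf V^{(s)}\mid V^{(s)}]=V^{(s)}\mathbf P$ for all $s$; - the comparisons follow the Bradley–Terry model: given $\mathbf V^{(s)}$, the outcomes of the comparisons of subject $s$ are independent, and $i$ beats $j$ in each comparison of $i$ with $j$ with probability $\sigma(\beta^*_i-\beta^*_j)$. For $S$ subjects put $\mathbf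 W=\sum_{s\le S}\mathbf W^{(s)}$, $V=\sum_{s\le S}V^{(s)}$, $\ell(\beta;\mathbf W)=\sum_{i\ne j}W_{ij}\log\sigma(\beta_i-\beta_j)$, and let $H(\beta;\mathbf W)$ be the Hessian matrix of $\ell(\cdot\,;\mathbf W)$ at $\beta$. A maximum likelihood estimate (MLE) under the sum constraint is a maximizer of $\ell(\cdot\,;\mathbf W)$ on $\{\beta:\sum_i\beta_i=0\}$. Let $\mathcal I(\beta^*)$ be the Fisher information matrix of one comparison, $$\mathcal I(\beta^*)=\sum_{i\neq j}P_{ij}\,\sigma(\beta^*_i-\beta^*_j)\,g_{ij}g_{ij}^\top,\qquad g_{ij}=\nabla_\beta\log\sigma(\beta_i-\beta_j)\big|_{\beta=\beta^*},$$ and let $A^\dagger$ denote the Moore–Penrose pseudoinverse of $A$. Suppose that for at least one $S$ the MLE under the sum constraint exists and is unique with positive probability, and let $\hat\beta=\hat\beta(\mathbf W)$ be any function of $\mathbf W$ that equals the MLE whenever the MLE exists and is unique. Then, as $S\to\infty$, $V\to\infty$ almost surely and $$\sqrt{V}\,(\hat\beta-\beta^*)\xrightarrow{d}\mathcal N\bigl(0,\mathcal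 I^\dagger(\beta^*)\bigr).$$ Moreover, the asymptotic variance is consistently estimated by means of $-H^\dagger(\hat\beta;\mathbf W)$: each entry of $-V\,H^\dagger(\hat\beta;\mathbf W)$ converges in probability to the corresponding entry of $\mathcal I^\dagger(\beta^*)$. -/

import Mathlib

open MeasureTheory ProbabilityTheory Filter Topology

/-! ### Moore–Penrose pseudoinverse of a real square matrix -/

/-- `X` is the pseudoinverse of `A`: the four Penrose conditions. -/
structure IsPseudoinverse {n : ℕ} (A X : Matrix (Fin n) (Fin n) ℝ) : Prop where
  mul_mul_left : A * X * A = A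
  mul_mul_right : X * A * X = X
  symm_left : (A * X).transpose = A * X
  symm_right : (X * A).transpose = X * A

theorem exists_symm_isPseudoinverse {n : ℕ} (A : Matrix (Fin n) (Fin n) ℝ)
    (hA : A.IsHermitian) : ∃ X, IsPseudoinverse A X ∧ X.transpose = X := by
  have hs := hA.spectral_theorem
  set U : Matrix (Fin n) (Fin n) ℝ := (hA.eigenvectorUnitary : Matrix (Fin n) (Fin n) ℝ) with hU
  have hUU : U.transpose * U = 1 := by
    have := Unitary.coe_star_mul_self hA.eigenvectorUnitary
    simpa [Matrix.star_eq_conjTranspose] using this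
  set d : Fin n → ℝ := hA.eigenvalues
  have hA' : A = U * Matrix.diagonal d * U.transpose := by
    rw [hs, Unitary.conjStarAlgAut_apply]
    simp [Matrix.star_eq_conjTranspose, hU, d]
  have key : ∀ a b : Fin n → ℝ, (U * Matrix.diagonal a * U.transpose) *
      (U * Matrix.diagonal b * U.transpose) =
      U * Matrix.diagonal (fun i => a i * b i) * U.transpose := by
    intro a b
    calc _ = U * Matrix.diagonal a * (U.transpose * U) * Matrix.diagonal b * U.transpose := by
          simp only [Matrix.mul_assoc]
      _ = _ := by rw [hUU, Matrix.mul_one, Matrix.mul_assoc U, Matrix.diagonal_mul_diagonal]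
  have keyT : ∀ a : Fin n → ℝ, (U * Matrix.diagonal a * U.transpose).transpose =
      U * Matrix.diagonal a * U.transpose := by
    intro a
    simp [Matrix.transpose_mul, Matrix.mul_assoc]
  refine ⟨U * Matrix.diagonal (fun i => (d i)⁻¹) * U.transpose, ⟨?_, ?_, ?_, ?_⟩, keyT _⟩
  · rw [hA', key, key]; congr 3; funext i; by_cases h : d i = 0 <;> simp [h]
  · rw [hA', key, key]
    congr 3
    funext i
    by_cases h : d i = 0 <;> simp [h]
  · rw [hA', key, keyT]
  · rw [hA', key, keyT]

theorem exists_isPseudoinverse {n : ℕ} (A : Matrix (Fin n) (Fin n) ℝ) :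
    ∃ X, IsPseudoinverse A X := by
  obtain ⟨Y, hY, hYt⟩ := exists_symm_isPseudoinverse (A.transpose * A)
    (by simpa using Matrix.isHermitian_conjTranspose_mul_self A)
  have hz : A - A * (Y * (A.transpose * A)) = 0 := by
    rw [← Matrix.conjTranspose_mul_self_eq_zero]
    have h1 : A.transpose * (A - A * (Y * (A.transpose * A))) = 0 := by
      have := hY.mul_mul_left
      rw [Matrix.mul_sub, sub_eq_zero]
      simpa only [Matrix.mul_assoc] using this.symm
    have h2 : (A - A * (Y * (A.transpose * A))).conjTranspose =
        (1 - (Y * (A.transpose * A)).transpose) * A.transpose := by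
      simp [Matrix.transpose_sub, Matrix.transpose_mul, Matrix.sub_mul, Matrix.mul_assoc]
    rw [h2, Matrix.mul_assoc, h1, Matrix.mul_zero]
  have hz' : A * (Y * (A.transpose * A)) = A := (sub_eq_zero.mp hz).symm
  refine ⟨Y * A.transpose, ⟨?_, ?_, ?_, ?_⟩⟩
  · simpa only [Matrix.mul_assoc] using hz'
  · have := congrArg (· * A.transpose) hY.mul_mul_right
    simpa only [Matrix.mul_assoc] using this
  · simp [Matrix.transpose_mul, hYt, Matrix.mul_assoc]
  · simpa only [Matrix.mul_assoc] using hY.symm_right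

theorem IsPseudoinverse.unique {n : ℕ} {A X Y : Matrix (Fin n) (Fin n) ℝ}
    (hX : IsPseudoinverse A X) (hY : IsPseudoinverse A Y) : X = Y := by
  have h1 : A * X = A * Y := by
    calc A * X = (A * X).transpose := hX.symm_left.symm
      _ = (A * Y * (A * X)).transpose := by rw [← Matrix.mul_assoc, hY.mul_mul_left]
      _ = A * X * (A * Y) := by rw [Matrix.transpose_mul, hX.symm_left, hY.symm_left]
      _ = A * Y := by rw [← Matrix.mul_assoc, hX.mul_mul_left]
  have h2 : X * A = Y * A := by
    calc X * A = (X * A).transpose := hX.symm_right.symm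
      _ = (X * A * (Y * A)).transpose := by
          rw [Matrix.mul_assoc X A, ← Matrix.mul_assoc A Y A, hY.mul_mul_left]
      _ = Y * A * (X * A) := by rw [Matrix.transpose_mul, hX.symm_right, hY.symm_right]
      _ = Y * A := by rw [Matrix.mul_assoc Y A, ← Matrix.mul_assoc A X A, hX.mul_mul_left]
  calc X = X * A * X := hX.mul_mul_right.symm
    _ = Y * A * X := by rw [h2]
    _ = Y * (A * X) := Matrix.mul_assoc _ _ _
    _ = Y * (A * Y) := by rw [h1]
    _ = Y * A * Y := (Matrix.mul_assoc _ _ _).symm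
    _ = Y := hY.mul_mul_right

/-- The pseudoinverse `A†` (it exists and is unique for every `A`). -/
noncomputable def pseudoinverse {n : ℕ} (A : Matrix (Fin n) (Fin n) ℝ) :
    Matrix (Fin n) (Fin n) ℝ :=
  Classical.choose (exists_isPseudoinverse A)

/-! ### The Bradley–Terry model

`W i j` is the number of times that object `i` beats object `j`. -/

/-- The set of contingency matrices is countable and carries the discrete σ-algebra. -/
instance instMeasurableSpaceNatMatrix {n : ℕ} : MeasurableSpace (Matrix (Fin n) (Fin n) ℕ) := ⊤

/-- The comparison matrix `V = W + Wᵀ`. -/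
def comparisonMatrix {n : ℕ} (W : Matrix (Fin n) (Fin n) ℕ) : Matrix (Fin n) (Fin n) ℕ :=
  W + W.transpose

/-- The number of comparisons recorded in `W`; each unordered pair of objects is counted once. -/
def numComparisons {n : ℕ} (W : Matrix (Fin n) (Fin n) ℕ) : ℕ :=
  ∑ i, ∑ j ∈ Finset.Ioi i, comparisonMatrix W i j

/-- The log-likelihood of the single outcome "`i` beats `j`". -/
noncomputable def pairLogLik {n : ℕ} (i j : Fin n) (b : EuclideanSpace ℝ (Fin n)) : ℝ :=
  Real.log (Real.sigmoid (b i - b j))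

/-- The log-likelihood `ℓ(b; W)`, a sum over the ordered pairs of distinct objects. -/
noncomputable def logLik {n : ℕ} (W : Matrix (Fin n) (Fin n) ℕ)
    (b : EuclideanSpace ℝ (Fin n)) : ℝ :=
  ∑ i, ∑ j ∈ Finset.univ.erase i, (W i j : ℝ) * pairLogLik i j b

/-- The Hessian matrix `H(b; W)` of the log-likelihood. -/
noncomputable def hessian {n : ℕ} (W : Matrix (Fin n) (Fin n) ℕ)
    (b : EuclideanSpace ℝ (Fin n)) : Matrix (Fin n) (Fin n) ℝ :=
  Matrix.of fun k l =>
    fderiv ℝ (fun x => fderiv ℝ (logLik W) x (EuclideanSpace.single l 1)) b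
      (EuclideanSpace.single k 1)

/-- `b` is a maximum likelihood estimate under the sum constraint `∑ i, b i = 0`. -/
def IsSumMLE {n : ℕ} (W : Matrix (Fin n) (Fin n) ℕ) (b : EuclideanSpace ℝ (Fin n)) : Prop :=
  ∑ i, b i = 0 ∧ ∀ c : EuclideanSpace ℝ (Fin n), ∑ i, c i = 0 → logLik W c ≤ logLik W b

/-- The Fisher information of one comparison (the second-moment matrix of its score), when the
unordered pair `{i, j}` is compared with frequency `P i j` and the scores of the objects are `b`:
the outcome "`i` beats `j`" then has probability `P i j * σ(b i - b j)`. -/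
noncomputable def fisherInfo {n : ℕ} (P : Matrix (Fin n) (Fin n) ℝ)
    (b : EuclideanSpace ℝ (Fin n)) : Matrix (Fin n) (Fin n) ℝ :=
  Matrix.of fun k l =>
    ∑ i, ∑ j ∈ Finset.univ.erase i, P i j * Real.sigmoid (b i - b j) *
      (gradient (pairLogLik i j) b k * gradient (pairLogLik i j) b l)

/-- The conditional probability of the contingency matrix `w` given its comparison matrix, when
all comparisons are independent and `i` beats `j` with probability `σ(b i - b j)`. -/
noncomputable def outcomeProb {n : ℕ} (b : EuclideanSpace ℝ (Fin n))
    (w : Matrix (Fin n) (Fin n) ℕ) : ℝ :=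
  ∏ i, ∏ j ∈ Finset.Ioi i, ((comparisonMatrix w i j).choose (w i j) : ℝ) *
    Real.sigmoid (b i - b j) ^ w i j * Real.sigmoid (b j - b i) ^ w j i

/-- The data collection design: `W s` is the contingency matrix of subject `s`, `P` the matrix of
comparison frequencies and `b` the vector of true scores. -/
structure IsSurvey {n : ℕ} {Ω : Type*} [MeasurableSpace Ω] (μ : Measure Ω)
    (W : ℕ → Ω → Matrix (Fin n) (Fin n) ℕ) (P : Matrix (Fin n) (Fin n) ℝ)
    (b : EuclideanSpace ℝ (Fin n)) : Prop where
  measurable : ∀ s, Measurable (W s)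
  /-- No object is compared with itself. -/
  diag_eq_zero : ∀ s ω i, W s ω i i = 0
  /-- The subjects are independent. -/
  indep : iIndepFun W μ
  /-- The numbers of comparisons made by the subjects are identically distributed. -/
  identDistrib : ∀ s, IdentDistrib (fun ω => numComparisons (W s ω))
    (fun ω => numComparisons (W 0 ω)) μ μ
  /-- They have finite variance and positive mean. -/
  memLp : MemLp (fun ω => (numComparisons (W 0 ω) : ℝ)) 2 μ
  mean_pos : 0 < ∫ ω, (numComparisons (W 0 ω) : ℝ) ∂μ
  freq_mem : ∀ i j, P i j ∈ Set.Icc (0 : ℝ) 1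
  /-- The equality assumption: the conditional expectation of the comparison matrix of a subject,
  given the number of comparisons that the subject makes, is that number times `P`. -/
  condExp_eq : ∀ s i j,
    μ[fun ω => (comparisonMatrix (W s ω) i j : ℝ) |
        MeasurableSpace.comap (fun ω => numComparisons (W s ω)) inferInstance]
      =ᵐ[μ] fun ω => (numComparisons (W s ω) : ℝ) * P i j
  /-- Given the comparison matrix, the outcomes of the comparisons are independent, and they
  follow the Bradley–Terry model with scores `b`. -/
  outcome_law : ∀ s (w : Matrix (Fin n) (Fin n) ℕ),
    μ.real {ω | W s ω = w} =
      μ.real {ω | comparisonMatrix (W s ω) = comparisonMatrix w} * outcomeProb b w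

/-- The pooled contingency matrix of the first `S` subjects. -/
def pooled {n : ℕ} {Ω : Type*} (W : ℕ → Ω → Matrix (Fin n) (Fin n) ℕ) (S : ℕ) (ω : Ω) :
    Matrix (Fin n) (Fin n) ℕ :=
  ∑ s ∈ Finset.range S, W s ω

/-! ### Pseudoinverses and weighted graph Laplacians -/

/-! The log-likelihood is concave and its Hessian is minus a weighted graph Laplacian
(`hessian_eq`); the Fisher information I is the Laplacian of the mean weights of one comparison
(`fisherInfo_eq`). A unique MLE with positive probability forces the graph of pairs with positive
frequency to be connected (`IsSurvey.eq_zero_of_freq`), so the kernel of I consists of the constant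
vectors only. Adding the projection `avgMatrix` then makes I invertible without changing it on
sum-zero vectors, and near I the pseudoinverse is an ordinary inverse minus that projection
(`pseudoinverse_eq_inv_sub`). This gives the continuity that pseudoinverses do not have in general.

Let κ be the mean number of comparisons per subject. The deterministic half works along any filter
on which the comparison counts divided by S converge and the score at β* is o(S). The score then has
a zero near β* (`eventually_exists_score_eq_zero`), concavity and connectedness make it the unique
MLE (`eventually_isSumMLE`), and a Laplacian of divided differences of σ (`score_sub_score`) gives
the exact identity S(β̂ - β*) = B · score(β*) with B → (κI)† (`exists_tendsto_linearization`).

The probabilistic half feeds in the data. Convergence in probability to a constant is convergence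
along `probFilter`, so the deterministic results apply as they stand. Only the totals V⁽ˢ⁾ are
identically distributed, not the contingency matrices; but the frequency assumption and the binomial
outcomes give every subject the same mean comparison matrix and a centered score with covariance κI,
and the score is dominated by a multiple of V⁽ˢ⁾. Hence Chebyshev yields the laws of large numbers
and a Lindeberg-type estimate the central limit theorem (`tendsto_charFun_sum_of_dominated`). By
Slutsky, √V(β̂ - β*) behaves like κ^(-1/2) I† applied to S^(-1/2) score(β*), with limiting
covariance I† I I† = I†. -/

theorem IsPseudoinverse.pseudoinverse_eq {n : ℕ} {A X : Matrix (Fin n) (Fin n) ℝ}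
    (h : IsPseudoinverse A X) : pseudoinverse A = X :=
  (Classical.choose_spec (exists_isPseudoinverse A)).unique h

theorem isPseudoinverse_pseudoinverse {n : ℕ} (A : Matrix (Fin n) (Fin n) ℝ) :
    IsPseudoinverse A (pseudoinverse A) :=
  Classical.choose_spec (exists_isPseudoinverse A)

theorem pseudoinverse_smul {n : ℕ} (c : ℝ) (A : Matrix (Fin n) (Fin n) ℝ) :
    pseudoinverse (c • A) = c⁻¹ • pseudoinverse A := by
  have h := isPseudoinverse_pseudoinverse A
  apply IsPseudoinverse.pseudoinverse_eq
  by_cases hc : c = 0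
  -- With `0⁻¹ = 0`, the formula also holds for the zero scalar.
  · subst hc
    constructor <;> simp
  have h1 : (c • A) * (c⁻¹ • pseudoinverse A) = A * pseudoinverse A := by
    rw [Matrix.smul_mul, Matrix.mul_smul, smul_smul, mul_inv_cancel₀ hc, one_smul]
  have h2 : (c⁻¹ • pseudoinverse A) * (c • A) = pseudoinverse A * A := by
    rw [Matrix.smul_mul, Matrix.mul_smul, smul_smul, inv_mul_cancel₀ hc, one_smul]
  constructor
  · rw [h1, Matrix.mul_smul, h.mul_mul_left]
  · rw [h2, Matrix.mul_smul, h.mul_mul_right]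
  · rw [h1, h.symm_left]
  · rw [h2, h.symm_right]

theorem pseudoinverse_transpose {n : ℕ} {A : Matrix (Fin n) (Fin n) ℝ}
    (hA : A.transpose = A) : (pseudoinverse A).transpose = pseudoinverse A := by
  obtain ⟨X, hX, hXt⟩ := exists_symm_isPseudoinverse A (by simpa [Matrix.IsHermitian] using hA)
  rw [hX.pseudoinverse_eq, hXt]

/-- The matrix of the orthogonal projection onto the constant vectors. -/
noncomputable def avgMatrix (n : ℕ) : Matrix (Fin n) (Fin n) ℝ := Matrix.of fun _ _ => (n : ℝ)⁻¹

theorem avgMatrix_mulVec {n : ℕ} (x : Fin n → ℝ) :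
    (avgMatrix n).mulVec x = fun _ => (n : ℝ)⁻¹ * ∑ i, x i := by
  ext k
  simp [avgMatrix, Matrix.mulVec, dotProduct, Finset.mul_sum]

theorem avgMatrix_transpose (n : ℕ) : (avgMatrix n).transpose = avgMatrix n := by
  ext; simp [avgMatrix]

theorem avgMatrix_mul_self (n : ℕ) : avgMatrix n * avgMatrix n = avgMatrix n := by
  ext k l
  have : (n : ℝ) ≠ 0 := by
    have := k.pos
    positivity
  simp [avgMatrix, Matrix.mul_apply]
  field_simp

/-- If `A` vanishes on the constant vectors, `A†` is obtained by inverting `A + avgMatrix n`. -/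
theorem pseudoinverse_eq_inv_sub {n : ℕ} {A : Matrix (Fin n) (Fin n) ℝ}
    (h1 : A * avgMatrix n = 0) (h2 : avgMatrix n * A = 0)
    (hdet : IsUnit (A + avgMatrix n).det) :
    pseudoinverse A = (A + avgMatrix n)⁻¹ - avgMatrix n := by
  set Q := avgMatrix n with hQ
  set B := A + Q with hB
  have hQQ : Q * Q = Q := avgMatrix_mul_self n
  have hBQ : B * Q = Q := by rw [hB, Matrix.add_mul, h1, hQQ, zero_add]
  have hQB : Q * B = Q := by rw [hB, Matrix.mul_add, h2, hQQ, zero_add]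
  have hBi : B⁻¹ * B = 1 := Matrix.nonsing_inv_mul _ hdet
  have hBi' : B * B⁻¹ = 1 := Matrix.mul_nonsing_inv _ hdet
  have hiQ : B⁻¹ * Q = Q := by
    calc B⁻¹ * Q = B⁻¹ * (B * Q) := by rw [hBQ]
      _ = Q := by rw [← Matrix.mul_assoc, hBi, Matrix.one_mul]
  have hQi : Q * B⁻¹ = Q := by
    calc Q * B⁻¹ = Q * B * B⁻¹ := by rw [hQB]
      _ = Q := by rw [Matrix.mul_assoc, hBi', Matrix.mul_one]
  have hA : A = B - Q := by rw [hB, add_sub_cancel_right]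
  -- `B` is the identity on constants and `A` on sum-zero vectors, so both products are the
  -- orthogonal projection onto the sum-zero vectors; the Penrose conditions follow.
  have hAX : A * (B⁻¹ - Q) = 1 - Q := by
    rw [Matrix.mul_sub, h1, sub_zero, hA, Matrix.sub_mul, hBi', hQi]
  have hXA : (B⁻¹ - Q) * A = 1 - Q := by
    rw [Matrix.sub_mul, h2, sub_zero, hA, Matrix.mul_sub, hBi, hiQ]
  have hQt : Q.transpose = Q := avgMatrix_transpose n
  apply IsPseudoinverse.pseudoinverse_eq
  constructor
  · rw [hAX, Matrix.sub_mul, h2, Matrix.one_mul, sub_zero]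
  · rw [hXA, Matrix.sub_mul, Matrix.mul_sub Q, hQi, hQQ, sub_self, sub_zero, Matrix.one_mul]
  · rw [hAX, Matrix.transpose_sub, hQt, Matrix.transpose_one]
  · rw [hXA, Matrix.transpose_sub, hQt, Matrix.transpose_one]

/-- The difference of the `i`-th and the `j`-th standard basis vectors. -/
noncomputable def contrast {n : ℕ} (i j : Fin n) : Fin n → ℝ := Pi.single i 1 - Pi.single j 1

theorem contrast_dotProduct {n : ℕ} (i j : Fin n) (x : Fin n → ℝ) :
    contrast i j ⬝ᵥ x = x i - x j := by
  simp [contrast, sub_dotProduct]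

theorem contrast_swap {n : ℕ} (i j : Fin n) : contrast i j = -contrast j i := by
  simp [contrast]

theorem contrast_self {n : ℕ} (i : Fin n) : contrast i i = 0 := by
  simp [contrast]

/-- The Laplacian matrix of the complete graph whose edges have the weights `c`. -/
noncomputable def laplacian {n : ℕ} (c : Fin n → Fin n → ℝ) : Matrix (Fin n) (Fin n) ℝ :=
  (1 / 2 : ℝ) • ∑ i, ∑ j, c i j • Matrix.vecMulVec (contrast i j) (contrast i j)

theorem laplacian_apply {n : ℕ} (c : Fin n → Fin n → ℝ) (k l : Fin n) :
    laplacian c k l = (1 / 2) * ∑ i, ∑ j, c i j * (contrast i j k * contrast i j l) := by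
  simp [laplacian, Matrix.sum_apply, Matrix.vecMulVec_apply]

theorem laplacian_smul {n : ℕ} (a : ℝ) (c : Fin n → Fin n → ℝ) :
    laplacian (fun i j => a * c i j) = a • laplacian c := by
  ext k l
  simp only [laplacian_apply, Matrix.smul_apply, smul_eq_mul, Finset.mul_sum]
  refine Finset.sum_congr rfl fun i _ => Finset.sum_congr rfl fun j _ => by ring

/-- Symmetrizing the weights. -/
theorem sum_mul_contrast_eq_laplacian {n : ℕ} (c : Fin n → Fin n → ℝ) (k l : Fin n) :
    ∑ i, ∑ j, c i j * (contrast i j k * contrast i j l) =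
      laplacian (fun i j => c i j + c j i) k l := by
  have h : ∑ i, ∑ j, c j i * (contrast i j k * contrast i j l) =
      ∑ i, ∑ j, c i j * (contrast i j k * contrast i j l) := by
    rw [Finset.sum_comm]
    refine Finset.sum_congr rfl fun i _ => Finset.sum_congr rfl fun j _ => ?_
    rw [contrast_swap j i]; simp
  rw [laplacian_apply]
  simp only [add_mul, Finset.sum_add_distrib, h]
  ring

theorem laplacian_transpose {n : ℕ} (c : Fin n → Fin n → ℝ) :
    (laplacian c).transpose = laplacian c := by
  ext k l
  simp only [Matrix.transpose_apply, laplacian_apply]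
  congr 1
  exact Finset.sum_congr rfl fun i _ => Finset.sum_congr rfl fun j _ => by ring

theorem laplacian_mulVec {n : ℕ} (c : Fin n → Fin n → ℝ) (x : Fin n → ℝ) (k : Fin n) :
    (laplacian c).mulVec x k = (1 / 2) * ∑ i, ∑ j, c i j * (x i - x j) * contrast i j k := by
  simp only [Matrix.mulVec, dotProduct, laplacian_apply]
  simp only [Finset.mul_sum, Finset.sum_mul]
  rw [Finset.sum_comm]
  refine Finset.sum_congr rfl fun i _ => ?_
  rw [Finset.sum_comm]
  refine Finset.sum_congr rfl fun j _ => ?_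
  rw [← contrast_dotProduct i j x, dotProduct]
  simp only [Finset.mul_sum, Finset.sum_mul]
  exact Finset.sum_congr rfl fun l _ => by ring

theorem dotProduct_laplacian_mulVec {n : ℕ} (c : Fin n → Fin n → ℝ) (x : Fin n → ℝ) :
    x ⬝ᵥ (laplacian c).mulVec x = (1 / 2) * ∑ i, ∑ j, c i j * (x i - x j) ^ 2 := by
  simp only [dotProduct, laplacian_mulVec]
  simp only [Finset.mul_sum]
  rw [Finset.sum_comm]
  refine Finset.sum_congr rfl fun i _ => ?_
  rw [Finset.sum_comm]
  refine Finset.sum_congr rfl fun j _ => ?_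
  have : ∑ k, x k * (1 / 2 * (c i j * (x i - x j) * contrast i j k)) =
      1 / 2 * (c i j * (x i - x j)) * (contrast i j ⬝ᵥ x) := by
    rw [dotProduct, Finset.mul_sum]
    exact Finset.sum_congr rfl fun k _ => by ring
  rw [this, contrast_dotProduct]
  ring

theorem laplacian_mul_avgMatrix {n : ℕ} (c : Fin n → Fin n → ℝ) :
    laplacian c * avgMatrix n = 0 := by
  ext k l
  have : (laplacian c * avgMatrix n) k l = (laplacian c).mulVec (fun _ => (n : ℝ)⁻¹) k := by
    simp [Matrix.mul_apply, Matrix.mulVec, dotProduct, avgMatrix]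
  rw [this, laplacian_mulVec]
  simp

theorem avgMatrix_mul_laplacian {n : ℕ} (c : Fin n → Fin n → ℝ) :
    avgMatrix n * laplacian c = 0 := by
  have := congrArg Matrix.transpose (laplacian_mul_avgMatrix c)
  rwa [Matrix.transpose_mul, avgMatrix_transpose, laplacian_transpose, Matrix.transpose_zero]
    at this

theorem tendsto_laplacian {n : ℕ} {ι : Type*} {l : Filter ι} {c : ι → Fin n → Fin n → ℝ}
    {c₀ : Fin n → Fin n → ℝ} (h : ∀ i j, Tendsto (fun x => c x i j) l (𝓝 (c₀ i j))) :
    Tendsto (fun x => laplacian (c x)) l (𝓝 (laplacian c₀)) := by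
  unfold laplacian
  refine Tendsto.const_smul ?_ _
  refine tendsto_finsetSum _ fun i _ => tendsto_finsetSum _ fun j _ => ?_
  exact (h i j).smul_const _

/-- The Laplacian of a connected graph is positive definite up to the constant vectors. -/
theorem dotProduct_laplacian_add_avgMatrix_pos {n : ℕ} {c : Fin n → Fin n → ℝ}
    (hc : ∀ i j, 0 ≤ c i j)
    (hconn : ∀ x : Fin n → ℝ, ∑ i, x i = 0 → (∀ i j, c i j * (x i - x j) ^ 2 = 0) → x = 0)
    {x : Fin n → ℝ} (hx : x ≠ 0) :
    0 < x ⬝ᵥ (laplacian c + avgMatrix n).mulVec x := by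
  have hQ : x ⬝ᵥ (avgMatrix n).mulVec x = (n : ℝ)⁻¹ * (∑ i, x i) ^ 2 := by
    rw [avgMatrix_mulVec]
    simp only [dotProduct]
    rw [← Finset.sum_mul]
    ring
  rw [Matrix.add_mulVec, dotProduct_add, dotProduct_laplacian_mulVec, hQ]
  have hnn : ∀ i j, 0 ≤ c i j * (x i - x j) ^ 2 := fun i j => mul_nonneg (hc i j) (sq_nonneg _)
  have hs : 0 ≤ ∑ i, ∑ j, c i j * (x i - x j) ^ 2 :=
    Finset.sum_nonneg fun i _ => Finset.sum_nonneg fun j _ => hnn i j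
  have hn : 0 < (n : ℝ) := by
    rcases Nat.eq_zero_or_pos n with h | h
    · subst h
      exact absurd (Subsingleton.elim x 0) hx
    · exact_mod_cast h
  have hq : 0 ≤ (n : ℝ)⁻¹ * (∑ i, x i) ^ 2 := by positivity
  -- Otherwise both nonnegative terms vanish: the projection term says that the sum is zero, the
  -- Laplacian term that `hconn` applies.
  by_contra hle
  have h1 : ∑ i, ∑ j, c i j * (x i - x j) ^ 2 = 0 := by linarith
  have h2 : (n : ℝ)⁻¹ * (∑ i, x i) ^ 2 = 0 := by linarith
  have h3 : ∑ i, x i = 0 := by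
    have := hn.ne'
    simpa [this] using h2
  refine hx (hconn x h3 fun i j => ?_)
  rw [Finset.sum_eq_zero_iff_of_nonneg
    (fun i _ => Finset.sum_nonneg fun j _ => hnn i j)] at h1
  exact (Finset.sum_eq_zero_iff_of_nonneg (fun j _ => hnn i j)).1 (h1 i (Finset.mem_univ i)) j
    (Finset.mem_univ j)

theorem isUnit_det_of_dotProduct_mulVec_pos {n : ℕ} {A : Matrix (Fin n) (Fin n) ℝ}
    (hA : ∀ x : Fin n → ℝ, x ≠ 0 → 0 < x ⬝ᵥ A.mulVec x) : IsUnit A.det := by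
  rw [isUnit_iff_ne_zero]
  intro h
  obtain ⟨x, hx, hAx⟩ := Matrix.exists_mulVec_eq_zero_iff.2 h
  have := hA x hx
  rw [hAx] at this
  simp at this

/-- A positive definite quadratic form is bounded below, uniformly in a neighbourhood. -/
theorem eventually_le_dotProduct_mulVec {n : ℕ} {A : Matrix (Fin n) (Fin n) ℝ}
    (hA : ∀ x : Fin n → ℝ, x ≠ 0 → 0 < x ⬝ᵥ A.mulVec x) :
    ∃ c : ℝ, 0 < c ∧ ∀ᶠ M in 𝓝 A, ∀ x : EuclideanSpace ℝ (Fin n),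
      c * ‖x‖ ^ 2 ≤ x.ofLp ⬝ᵥ M.mulVec x.ofLp := by
  obtain ⟨c, hc, hcA⟩ : ∃ c : ℝ, 0 < c ∧ ∀ x : EuclideanSpace ℝ (Fin n), ‖x‖ = 1 →
      c ≤ x.ofLp ⬝ᵥ A.mulVec x.ofLp := by
    have hcont : Continuous fun x : EuclideanSpace ℝ (Fin n) => x.ofLp ⬝ᵥ A.mulVec x.ofLp := by
      unfold Matrix.mulVec dotProduct
      fun_prop
    rcases (Metric.sphere (0 : EuclideanSpace ℝ (Fin n)) 1).eq_empty_or_nonempty with he | hne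
    · refine ⟨1, one_pos, fun x hx => ?_⟩
      have : x ∈ Metric.sphere (0 : EuclideanSpace ℝ (Fin n)) 1 := by simpa using hx
      simp [he] at this
    · obtain ⟨y, hy, hmin⟩ := (isCompact_sphere (0 : EuclideanSpace ℝ (Fin n)) 1).exists_isMinOn
        hne hcont.continuousOn
      refine ⟨_, hA y.ofLp ?_, fun x hx => hmin (by simpa using hx)⟩
      intro h0
      have : y = 0 := by ext i; simp [h0]
      simp [this] at hy
  -- `c` bounds the form on the compact unit sphere; half of it absorbs a small entrywise
  -- perturbation of the matrix.
  refine ⟨c / 2, by positivity, ?_⟩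
  have hev : ∀ᶠ M in 𝓝 A, ∑ k, ∑ l, |M k l - A k l| < c / 2 := by
    have ht : Tendsto (fun M : Matrix (Fin n) (Fin n) ℝ => ∑ k, ∑ l, |M k l - A k l|) (𝓝 A)
        (𝓝 (∑ k, ∑ l, |A k l - A k l|)) := by
      have : Continuous fun M : Matrix (Fin n) (Fin n) ℝ => ∑ k, ∑ l, |M k l - A k l| := by
        refine continuous_finsetSum _ fun k _ => continuous_finsetSum _ fun l _ => ?_
        exact ((continuous_id.matrix_elem k l).sub continuous_const).abs
      exact this.tendsto A
    exact ht.eventually_lt_const (by simpa using hc)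
  filter_upwards [hev] with M hM
  have key : ∀ x : EuclideanSpace ℝ (Fin n), ‖x‖ = 1 →
      c / 2 ≤ x.ofLp ⬝ᵥ M.mulVec x.ofLp := by
    intro x hx
    have hco : ∀ i, |x.ofLp i| ≤ 1 := fun i => by
      have := PiLp.norm_apply_le x i
      rwa [hx, Real.norm_eq_abs] at this
    have hd : x.ofLp ⬝ᵥ A.mulVec x.ofLp - x.ofLp ⬝ᵥ M.mulVec x.ofLp ≤
        ∑ k, ∑ l, |M k l - A k l| := by
      simp only [dotProduct, Matrix.mulVec, Finset.mul_sum]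
      rw [← Finset.sum_sub_distrib]
      refine Finset.sum_le_sum fun k _ => ?_
      rw [← Finset.sum_sub_distrib]
      refine Finset.sum_le_sum fun l _ => ?_
      calc x.ofLp k * (A k l * x.ofLp l) - x.ofLp k * (M k l * x.ofLp l)
          ≤ |x.ofLp k * (A k l * x.ofLp l) - x.ofLp k * (M k l * x.ofLp l)| := le_abs_self _
        _ = |x.ofLp k| * |x.ofLp l| * |M k l - A k l| := by
            rw [← abs_mul, abs_sub_comm, ← abs_mul]; congr 1; ring
        _ ≤ 1 * |M k l - A k l| := by
            gcongr
            exact mul_le_one₀ (hco k) (abs_nonneg _) (hco l)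
        _ = _ := one_mul _
    linarith [hcA x hx]
  intro x
  by_cases hx : x = 0
  · simp [hx]
  have hn : 0 < ‖x‖ := norm_pos_iff.2 hx
  have h1 := key (‖x‖⁻¹ • x) (by rw [norm_smul, norm_inv, norm_norm, inv_mul_cancel₀ hn.ne'])
  simp only [WithLp.ofLp_smul, Matrix.mulVec_smul, smul_dotProduct, dotProduct_smul,
    smul_eq_mul] at h1
  have h2 := mul_le_mul_of_nonneg_right h1 (sq_nonneg ‖x‖)
  calc c / 2 * ‖x‖ ^ 2 ≤ _ := h2
    _ = _ := by field_simp

/-! ### Score and Hessian of the log-likelihood -/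

/-- The probability that `i` beats `j`, times the probability that `j` beats `i`. -/
noncomputable def winVar {n : ℕ} (b : EuclideanSpace ℝ (Fin n)) (i j : Fin n) : ℝ :=
  Real.sigmoid (b i - b j) * Real.sigmoid (b j - b i)

theorem winVar_pos {n : ℕ} (b : EuclideanSpace ℝ (Fin n)) (i j : Fin n) : 0 < winVar b i j :=
  mul_pos (Real.sigmoid_pos _) (Real.sigmoid_pos _)

theorem winVar_comm {n : ℕ} (b : EuclideanSpace ℝ (Fin n)) (i j : Fin n) :
    winVar b i j = winVar b j i := mul_comm _ _

theorem sigmoid_sub_swap (a b : ℝ) : Real.sigmoid (b - a) = 1 - Real.sigmoid (a - b) := by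
  rw [← Real.sigmoid_neg, neg_sub]

theorem hasDerivAt_log_sigmoid (t : ℝ) :
    HasDerivAt (fun t => Real.log (Real.sigmoid t)) (Real.sigmoid (-t)) t := by
  have h := (Real.hasDerivAt_sigmoid t).log (Real.sigmoid_pos t).ne'
  rw [mul_div_cancel_left₀ _ (Real.sigmoid_pos t).ne'] at h
  rwa [Real.sigmoid_neg]

/-- The linear form `x ↦ x i - x j`. -/
noncomputable def contrastCLM {n : ℕ} (i j : Fin n) : EuclideanSpace ℝ (Fin n) →L[ℝ] ℝ :=
  EuclideanSpace.proj i - EuclideanSpace.proj j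

@[simp] theorem contrastCLM_apply {n : ℕ} (i j : Fin n) (x : EuclideanSpace ℝ (Fin n)) :
    contrastCLM i j x = x i - x j := by
  simp [contrastCLM]

theorem contrastCLM_single {n : ℕ} (i j k : Fin n) :
    contrastCLM i j (EuclideanSpace.single k 1) = contrast i j k := by
  simp [contrast, Pi.single_apply, eq_comm]

theorem hasFDerivAt_pairLogLik {n : ℕ} (i j : Fin n) (b : EuclideanSpace ℝ (Fin n)) :
    HasFDerivAt (pairLogLik i j) (Real.sigmoid (b j - b i) • contrastCLM i j) b := by
  have h := (hasDerivAt_log_sigmoid (contrastCLM i j b)).comp_hasFDerivAt b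
    (contrastCLM i j).hasFDerivAt
  rw [contrastCLM_apply, neg_sub] at h
  have e : pairLogLik i j = (fun t => Real.log (Real.sigmoid t)) ∘ contrastCLM i j := by
    funext x
    simp [pairLogLik]
  rw [e]
  exact h

theorem gradient_pairLogLik {n : ℕ} (i j k : Fin n) (b : EuclideanSpace ℝ (Fin n)) :
    gradient (pairLogLik i j) b k = Real.sigmoid (b j - b i) * contrast i j k := by
  have h1 : inner ℝ (gradient (pairLogLik i j) b) (EuclideanSpace.single k 1) =
      fderiv ℝ (pairLogLik i j) b (EuclideanSpace.single k 1) := by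
    simp [gradient]
  rw [(hasFDerivAt_pairLogLik i j b).fderiv] at h1
  simp only [smul_apply, contrastCLM_single, smul_eq_mul] at h1
  rw [← h1, EuclideanSpace.inner_single_right]
  simp

theorem sum_erase_of_self_eq_zero {n : ℕ} (f : Fin n → Fin n → ℝ) (h : ∀ i, f i i = 0) :
    ∑ i, ∑ j ∈ Finset.univ.erase i, f i j = ∑ i, ∑ j, f i j :=
  Finset.sum_congr rfl fun i _ => Finset.sum_erase _ (h i)

/-- The score, i.e. the gradient of the log-likelihood. -/
noncomputable def score {n : ℕ} (w : Matrix (Fin n) (Fin n) ℕ) (b : EuclideanSpace ℝ (Fin n))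
    (k : Fin n) : ℝ :=
  ∑ i, ∑ j, (w i j : ℝ) * Real.sigmoid (b j - b i) * contrast i j k

theorem score_dotProduct {n : ℕ} (w : Matrix (Fin n) (Fin n) ℕ) (b : EuclideanSpace ℝ (Fin n))
    (x : Fin n → ℝ) :
    score w b ⬝ᵥ x = ∑ i, ∑ j, (w i j : ℝ) * Real.sigmoid (b j - b i) * (x i - x j) := by
  simp only [dotProduct, score, Finset.sum_mul]
  rw [Finset.sum_comm]
  refine Finset.sum_congr rfl fun i _ => ?_
  rw [Finset.sum_comm]
  refine Finset.sum_congr rfl fun j _ => ?_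
  rw [← contrast_dotProduct i j x, dotProduct, Finset.mul_sum]
  exact Finset.sum_congr rfl fun l _ => by ring

theorem hasFDerivAt_logLik {n : ℕ} (w : Matrix (Fin n) (Fin n) ℕ)
    (b : EuclideanSpace ℝ (Fin n)) :
    HasFDerivAt (logLik w) (∑ i, ∑ j ∈ Finset.univ.erase i,
      (w i j : ℝ) • Real.sigmoid (b j - b i) • contrastCLM i j) b := by
  unfold logLik
  exact HasFDerivAt.fun_sum fun i _ => HasFDerivAt.fun_sum fun j _ =>
    (hasFDerivAt_pairLogLik i j b).const_mul _

theorem fderiv_logLik_apply {n : ℕ} (w : Matrix (Fin n) (Fin n) ℕ)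
    (b x : EuclideanSpace ℝ (Fin n)) :
    fderiv ℝ (logLik w) b x = score w b ⬝ᵥ x.ofLp := by
  rw [(hasFDerivAt_logLik w b).fderiv, score_dotProduct]
  simp only [sum_apply, smul_apply, contrastCLM_apply,
    smul_eq_mul, ← mul_assoc]
  exact sum_erase_of_self_eq_zero _ fun i => by simp

theorem fderiv_logLik_single {n : ℕ} (w : Matrix (Fin n) (Fin n) ℕ)
    (b : EuclideanSpace ℝ (Fin n)) (k : Fin n) :
    fderiv ℝ (logLik w) b (EuclideanSpace.single k 1) = score w b k := by
  rw [fderiv_logLik_apply]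
  simp

theorem hasFDerivAt_score {n : ℕ} (w : Matrix (Fin n) (Fin n) ℕ) (b : EuclideanSpace ℝ (Fin n))
    (k : Fin n) :
    HasFDerivAt (fun b => score w b k)
      (∑ i, ∑ j, ((w i j : ℝ) * contrast i j k) • (winVar b i j • contrastCLM j i)) b := by
  have h : ∀ i j, HasFDerivAt (fun b : EuclideanSpace ℝ (Fin n) => Real.sigmoid (b j - b i))
      (winVar b i j • contrastCLM j i) b := by
    intro i j
    have h := (Real.hasDerivAt_sigmoid (contrastCLM j i b)).comp_hasFDerivAt b
      (contrastCLM j i).hasFDerivAt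
    rw [contrastCLM_apply] at h
    have e : (fun b : EuclideanSpace ℝ (Fin n) => Real.sigmoid (b j - b i)) =
        Real.sigmoid ∘ contrastCLM j i := by
      funext x
      simp
    rw [e, winVar, sigmoid_sub_swap (b j) (b i), mul_comm]
    exact h
  have : (fun b => score w b k) = fun b : EuclideanSpace ℝ (Fin n) =>
      ∑ i, ∑ j, ((w i j : ℝ) * contrast i j k) * Real.sigmoid (b j - b i) := by
    ext b
    exact Finset.sum_congr rfl fun i _ => Finset.sum_congr rfl fun j _ => by ring
  rw [this]
  exact HasFDerivAt.fun_sum fun i _ => HasFDerivAt.fun_sum fun j _ => (h i j).const_mul _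

/-- The derivative of σ is even, so a win of either object contributes the same curvature, and the
Hessian depends on the data through the comparison counts alone. -/
theorem hessian_eq {n : ℕ} (w : Matrix (Fin n) (Fin n) ℕ) (b : EuclideanSpace ℝ (Fin n)) :
    hessian w b = -laplacian fun i j => (comparisonMatrix w i j : ℝ) * winVar b i j := by
  ext k l
  simp only [hessian, Matrix.of_apply, fderiv_logLik_single, (hasFDerivAt_score w b l).fderiv]
  have h := sum_mul_contrast_eq_laplacian (fun i j => (w i j : ℝ) * winVar b i j) k l
  have h' : (fun i j => (comparisonMatrix w i j : ℝ) * winVar b i j) =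
      fun i j => (w i j : ℝ) * winVar b i j + (w j i : ℝ) * winVar b j i := by
    ext i j
    rw [winVar_comm b j i, ← add_mul]
    simp [comparisonMatrix]
  rw [h', Matrix.neg_apply, ← h, ← Finset.sum_neg_distrib]
  simp only [sum_apply, smul_apply, contrastCLM_single,
    smul_eq_mul]
  refine Finset.sum_congr rfl fun i _ => ?_
  rw [← Finset.sum_neg_distrib]
  refine Finset.sum_congr rfl fun j _ => ?_
  rw [contrast_swap j i]
  simp only [Pi.neg_apply]
  ring

/-- The two outcomes of a pair add up to `P i j * winVar b i j` because their probabilities sum to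
one. This is the information identity: second moment of the score equals minus the mean Hessian. -/
theorem fisherInfo_eq {n : ℕ} {P : Matrix (Fin n) (Fin n) ℝ} (hP : ∀ i j, P i j = P j i)
    (b : EuclideanSpace ℝ (Fin n)) :
    fisherInfo P b = laplacian fun i j => P i j * winVar b i j := by
  ext k l
  simp only [fisherInfo, Matrix.of_apply, gradient_pairLogLik]
  rw [sum_erase_of_self_eq_zero _ fun i => by simp [contrast_self]]
  have h := sum_mul_contrast_eq_laplacian
    (fun i j => P i j * winVar b i j * Real.sigmoid (b j - b i)) k l
  have h' : (fun i j => P i j * winVar b i j) = fun i j =>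
      P i j * winVar b i j * Real.sigmoid (b j - b i) +
        P j i * winVar b j i * Real.sigmoid (b i - b j) := by
    ext i j
    rw [winVar_comm b j i, hP j i, sigmoid_sub_swap (b i) (b j)]
    ring
  rw [h', ← h]
  refine Finset.sum_congr rfl fun i _ => Finset.sum_congr rfl fun j _ => ?_
  simp only [winVar]
  ring

/-- The divided differences of `Real.sigmoid` between the vectors `a` and `b`. -/
noncomputable def winSlope {n : ℕ} (a b : EuclideanSpace ℝ (Fin n)) (i j : Fin n) : ℝ :=
  dslope Real.sigmoid (a i - a j) (b i - b j)

theorem deriv_sigmoid_sub {n : ℕ} (a : EuclideanSpace ℝ (Fin n)) (i j : Fin n) :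
    deriv Real.sigmoid (a i - a j) = winVar a i j := by
  rw [Real.deriv_sigmoid, winVar, sigmoid_sub_swap (a i) (a j)]

theorem winSlope_pos {n : ℕ} (a b : EuclideanSpace ℝ (Fin n)) (i j : Fin n) :
    0 < winSlope a b i j := by
  unfold winSlope
  by_cases h : b i - b j = a i - a j
  · rw [h, dslope_same, deriv_sigmoid_sub]
    exact winVar_pos a i j
  · rw [dslope_of_ne _ h, slope_def_field]
    rcases lt_or_gt_of_ne h with h | h
    · exact div_pos_of_neg_of_neg (sub_neg.2 (Real.sigmoid_lt h)) (sub_neg.2 h)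
    · exact div_pos (sub_pos.2 (Real.sigmoid_lt h)) (sub_pos.2 h)

theorem sigmoid_sub_sigmoid {n : ℕ} (a b : EuclideanSpace ℝ (Fin n)) (i j : Fin n) :
    Real.sigmoid (b i - b j) - Real.sigmoid (a i - a j) =
      winSlope a b i j * ((b i - a i) - (b j - a j)) := by
  rw [← sub_smul_dslope, smul_eq_mul, winSlope, mul_comm]
  congr 1
  ring

/-- A consequence of σ(-t) = 1 - σ(t). It makes the secant weights symmetric, so that wins of `i`
and of `j` merge into a comparison count in `score_sub_score`. -/
theorem winSlope_comm {n : ℕ} (a b : EuclideanSpace ℝ (Fin n)) (i j : Fin n) :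
    winSlope a b i j = winSlope a b j i := by
  by_cases h : b i - b j = a i - a j
  · have h' : b j - b i = a j - a i := by linarith
    rw [winSlope, winSlope, h, h', dslope_same, dslope_same, deriv_sigmoid_sub,
      deriv_sigmoid_sub, winVar_comm]
  · have h1 := sigmoid_sub_sigmoid a b i j
    have h2 := sigmoid_sub_sigmoid a b j i
    rw [sigmoid_sub_swap (b i), sigmoid_sub_swap (a i)] at h2
    have h3 : (b i - a i) - (b j - a j) ≠ 0 := fun h0 => h (by linarith)
    apply mul_right_cancel₀ h3
    linarith

theorem tendsto_winSlope {n : ℕ} (a : EuclideanSpace ℝ (Fin n)) (i j : Fin n) :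
    Tendsto (fun b => winSlope a b i j) (𝓝 a) (𝓝 (winVar a i j)) := by
  have h : ContinuousAt (dslope Real.sigmoid (a i - a j)) (a i - a j) :=
    continuousAt_dslope_same.2 (Real.hasDerivAt_sigmoid _).differentiableAt
  have h' := h.tendsto
  rw [dslope_same, deriv_sigmoid_sub] at h'
  have hc : Continuous fun b : EuclideanSpace ℝ (Fin n) => b i - b j := by fun_prop
  exact h'.comp (hc.tendsto a)

/-- The mean value theorem for the score, with a Laplacian in the place of the Hessian. -/
theorem score_sub_score {n : ℕ} (w : Matrix (Fin n) (Fin n) ℕ)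
    (a b : EuclideanSpace ℝ (Fin n)) :
    score w b - score w a =
      -(laplacian fun i j => (comparisonMatrix w i j : ℝ) * winSlope a b i j).mulVec
        (b - a).ofLp := by
  ext k
  have h' : (fun i j => (comparisonMatrix w i j : ℝ) * winSlope a b i j) =
      fun i j => (w i j : ℝ) * winSlope a b i j + (w j i : ℝ) * winSlope a b j i := by
    ext i j
    rw [winSlope_comm a b j i, ← add_mul]
    simp [comparisonMatrix]
  have hL : (laplacian fun i j => (comparisonMatrix w i j : ℝ) * winSlope a b i j).mulVec
      (b - a).ofLp k = ∑ i, ∑ j, (w i j : ℝ) * winSlope a b i j *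
        ((b i - a i) - (b j - a j)) * contrast i j k := by
    have : ∀ l, (laplacian fun i j => (comparisonMatrix w i j : ℝ) * winSlope a b i j) k l *
        (b - a).ofLp l = ∑ i, ∑ j, (w i j : ℝ) * winSlope a b i j *
          contrast i j k * (contrast i j l * (b - a).ofLp l) := by
      intro l
      rw [h', ← sum_mul_contrast_eq_laplacian]
      simp only [Finset.sum_mul]
      exact Finset.sum_congr rfl fun i _ => Finset.sum_congr rfl fun j _ => by ring
    simp only [Matrix.mulVec, dotProduct, this]
    rw [Finset.sum_comm]
    refine Finset.sum_congr rfl fun i _ => ?_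
    rw [Finset.sum_comm]
    refine Finset.sum_congr rfl fun j _ => ?_
    have hc := contrast_dotProduct i j (b - a).ofLp
    rw [dotProduct] at hc
    rw [← Finset.mul_sum, hc]
    simp only [WithLp.ofLp_sub, Pi.sub_apply]
    ring
  rw [Pi.neg_apply, hL, Pi.sub_apply, score, score, ← Finset.sum_sub_distrib,
    ← Finset.sum_neg_distrib]
  refine Finset.sum_congr rfl fun i _ => ?_
  rw [← Finset.sum_sub_distrib, ← Finset.sum_neg_distrib]
  refine Finset.sum_congr rfl fun j _ => ?_
  have h1 := sigmoid_sub_sigmoid a b i j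
  rw [sigmoid_sub_swap (b i), sigmoid_sub_swap (a i)]
  linear_combination (-(w i j : ℝ) * contrast i j k) * h1

theorem sum_score {n : ℕ} (w : Matrix (Fin n) (Fin n) ℕ) (b : EuclideanSpace ℝ (Fin n)) :
    ∑ k, score w b k = 0 := by
  have := score_dotProduct w b 1
  simpa [dotProduct] using this

/-! ### Concavity of the log-likelihood and maximum likelihood estimates -/

/-- This tangent bound, the concavity of log σ, is Jensen's inequality for `exp` at the points 0 and
-(y - x) with weights σ(x) and σ(-x): the weighted mean of the exponentials is σ(x)/σ(y). -/
theorem log_sigmoid_le (x y : ℝ) :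
    Real.log (Real.sigmoid y) ≤ Real.log (Real.sigmoid x) + Real.sigmoid (-x) * (y - x) := by
  have hx := Real.sigmoid_pos x
  have hy := Real.sigmoid_pos y
  have hnx := Real.sigmoid_pos (-x)
  have h1 : Real.exp (-(Real.sigmoid (-x) * (y - x))) ≤
      Real.sigmoid x + Real.sigmoid (-x) * Real.exp (-(y - x)) := by
    have hs : Real.sigmoid x + Real.sigmoid (-x) = 1 := by rw [Real.sigmoid_neg]; ring
    have := convexOn_exp.2 (Set.mem_univ 0) (Set.mem_univ (-(y - x))) hx.le hnx.le hs
    simp only [smul_eq_mul, mul_zero, zero_add, Real.exp_zero, mul_one] at this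
    rwa [mul_neg] at this
  have h2 : Real.sigmoid x + Real.sigmoid (-x) * Real.exp (-(y - x)) =
      Real.sigmoid x / Real.sigmoid y := by
    have e1 : Real.exp (-y) = Real.exp (-x) * Real.exp (-(y - x)) := by
      rw [← Real.exp_add]; congr 1; ring
    have e2 := Real.sigmoid_mul_rexp_neg x
    rw [← e2, Real.sigmoid_def y, div_inv_eq_mul, e1]
    ring
  rw [h2] at h1
  have h3 := Real.log_le_log (Real.exp_pos _) h1
  rw [Real.log_exp, Real.log_div hx.ne' hy.ne'] at h3
  linarith

theorem logLik_le {n : ℕ} (w : Matrix (Fin n) (Fin n) ℕ) (b c : EuclideanSpace ℝ (Fin n)) :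
    logLik w c ≤ logLik w b + score w b ⬝ᵥ (c - b).ofLp := by
  rw [score_dotProduct, ← sum_erase_of_self_eq_zero _ (fun i => by simp), logLik, logLik,
    ← Finset.sum_add_distrib]
  refine Finset.sum_le_sum fun i _ => ?_
  rw [← Finset.sum_add_distrib]
  refine Finset.sum_le_sum fun j _ => ?_
  have h := log_sigmoid_le (b i - b j) (c i - c j)
  rw [mul_assoc, ← mul_add]
  refine mul_le_mul_of_nonneg_left ?_ (Nat.cast_nonneg _)
  rw [neg_sub] at h
  simp only [pairLogLik, WithLp.ofLp_sub, Pi.sub_apply]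
  calc _ ≤ _ := h
    _ = _ := by ring

/-- Used for two kinds of flat direction: the constant vectors, and vectors that are constant on
each component of a disconnected comparison graph. -/
theorem logLik_congr {n : ℕ} (w : Matrix (Fin n) (Fin n) ℕ) {b c : EuclideanSpace ℝ (Fin n)}
    (h : ∀ i j, i ≠ j → w i j ≠ 0 → b i - b j = c i - c j) : logLik w b = logLik w c := by
  refine Finset.sum_congr rfl fun i _ => Finset.sum_congr rfl fun j hj => ?_
  by_cases hw : w i j = 0
  · simp [hw]
  · rw [pairLogLik, pairLogLik, h i j (Finset.ne_of_mem_erase hj).symm hw]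

/-- The orthogonal projection onto the vectors with sum zero. -/
noncomputable def centered {n : ℕ} (b : EuclideanSpace ℝ (Fin n)) : EuclideanSpace ℝ (Fin n) :=
  WithLp.toLp 2 fun k => b k - (n : ℝ)⁻¹ * ∑ i, b i

theorem sum_centered {n : ℕ} (b : EuclideanSpace ℝ (Fin n)) : ∑ k, centered b k = 0 := by
  rcases Nat.eq_zero_or_pos n with h | h
  · subst h; simp
  · have : (n : ℝ) ≠ 0 := by positivity
    simp [centered, Finset.sum_sub_distrib, this]

theorem centered_of_sum_eq_zero {n : ℕ} {b : EuclideanSpace ℝ (Fin n)} (h : ∑ k, b k = 0) :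
    centered b = b := by
  ext k; simp [centered, h]

theorem continuous_centered {n : ℕ} :
    Continuous (centered : EuclideanSpace ℝ (Fin n) → EuclideanSpace ℝ (Fin n)) := by
  unfold centered
  fun_prop

theorem logLik_centered {n : ℕ} (w : Matrix (Fin n) (Fin n) ℕ) (b : EuclideanSpace ℝ (Fin n)) :
    logLik w (centered b) = logLik w b :=
  logLik_congr w fun i j _ _ => by simp [centered]

theorem score_eq_zero_of_isLocalMax {n : ℕ} {w : Matrix (Fin n) (Fin n) ℕ}
    {b : EuclideanSpace ℝ (Fin n)} (h : IsLocalMax (logLik w) b) : score w b = 0 := by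
  ext k
  rw [← fderiv_logLik_single, h.fderiv_eq_zero]
  simp

/-- Centering does not change the likelihood, so the constrained maximizer is a global one and no
Lagrange multiplier appears. -/
theorem IsSumMLE.score_eq_zero {n : ℕ} {w : Matrix (Fin n) (Fin n) ℕ}
    {b : EuclideanSpace ℝ (Fin n)} (h : IsSumMLE w b) : score w b = 0 := by
  refine score_eq_zero_of_isLocalMax (Eventually.of_forall fun c => ?_)
  rw [← logLik_centered w c]
  exact h.2 _ (sum_centered c)

theorem isSumMLE_of_score_eq_zero {n : ℕ} {w : Matrix (Fin n) (Fin n) ℕ}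
    {b : EuclideanSpace ℝ (Fin n)} (hb : ∑ i, b i = 0) (h : score w b = 0) : IsSumMLE w b :=
  ⟨hb, fun c _ => by simpa [h] using logLik_le w b c⟩

/-- The secant Laplacian kills `b - a`. Its edge weights are positive on every compared pair, so `b
- a` is constant across these pairs and connectedness finishes. -/
theorem score_eq_zero_unique {n : ℕ} {w : Matrix (Fin n) (Fin n) ℕ}
    (hconn : ∀ x : Fin n → ℝ, ∑ i, x i = 0 →
      (∀ i j, (comparisonMatrix w i j : ℝ) * (x i - x j) ^ 2 = 0) → x = 0)
    {a b : EuclideanSpace ℝ (Fin n)} (ha : ∑ i, a i = 0) (hb : ∑ i, b i = 0)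
    (hsa : score w a = 0) (hsb : score w b = 0) : b = a := by
  have h := score_sub_score w a b
  rw [hsa, hsb, sub_zero, eq_comm, neg_eq_zero] at h
  have hq := dotProduct_laplacian_mulVec
    (fun i j => (comparisonMatrix w i j : ℝ) * winSlope a b i j) (b - a).ofLp
  rw [h, dotProduct_zero] at hq
  have hnn : ∀ i j, 0 ≤ (comparisonMatrix w i j : ℝ) * winSlope a b i j *
      ((b - a).ofLp i - (b - a).ofLp j) ^ 2 := fun i j =>
    mul_nonneg (mul_nonneg (Nat.cast_nonneg _) (winSlope_pos a b i j).le) (sq_nonneg _)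
  have h1 : ∑ i, ∑ j, (comparisonMatrix w i j : ℝ) * winSlope a b i j *
      ((b - a).ofLp i - (b - a).ofLp j) ^ 2 = 0 := by linarith
  rw [Finset.sum_eq_zero_iff_of_nonneg
    (fun i _ => Finset.sum_nonneg fun j _ => hnn i j)] at h1
  have h2 : (b - a).ofLp = 0 := by
    refine hconn _ (by simp [Finset.sum_sub_distrib, ha, hb]) fun i j => ?_
    have h3 := (Finset.sum_eq_zero_iff_of_nonneg (fun j _ => hnn i j)).1
      (h1 i (Finset.mem_univ i)) j (Finset.mem_univ j)
    have h4 := (winSlope_pos a b i j).ne'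
    simp only [mul_eq_zero, h4, or_false] at h3
    simpa using h3
  rw [← sub_eq_zero]
  ext i
  exact congrFun h2 i

/-! ### Behaviour of the maximum likelihood estimate for large samples -/

theorem dotProduct_add_avgMatrix_mulVec {n : ℕ} (M : Matrix (Fin n) (Fin n) ℝ) {x : Fin n → ℝ}
    (hx : ∑ i, x i = 0) : x ⬝ᵥ (M + avgMatrix n).mulVec x = x ⬝ᵥ M.mulVec x := by
  rw [Matrix.add_mulVec, avgMatrix_mulVec, hx, dotProduct_add]
  simp

theorem abs_dotProduct_le {n : ℕ} (u : Fin n → ℝ) (x : EuclideanSpace ℝ (Fin n)) :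
    u ⬝ᵥ x.ofLp ≤ (∑ k, |u k|) * ‖x‖ := by
  rw [dotProduct, Finset.sum_mul]
  refine Finset.sum_le_sum fun k _ => ?_
  calc u k * x.ofLp k ≤ |u k * x.ofLp k| := le_abs_self _
    _ = |u k| * |x.ofLp k| := abs_mul _ _
    _ ≤ |u k| * ‖x‖ := by
        gcongr
        simpa using PiLp.norm_apply_le x k

theorem continuous_logLik {n : ℕ} (w : Matrix (Fin n) (Fin n) ℕ) : Continuous (logLik w) :=
  continuous_iff_continuousAt.2 fun b => (hasFDerivAt_logLik w b).continuousAt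

/-- A quadratic upper bound of the log-likelihood, from two tangents and the mean value theorem
for the score. -/
theorem logLik_le_quadratic {n : ℕ} (w : Matrix (Fin n) (Fin n) ℕ)
    (a b m : EuclideanSpace ℝ (Fin n)) (hm : m = a + (1 / 2 : ℝ) • (b - a)) :
    logLik w b ≤ logLik w a + score w a ⬝ᵥ (b - a).ofLp - (1 / 4) *
      ((b - a).ofLp ⬝ᵥ (laplacian fun i j =>
        (comparisonMatrix w i j : ℝ) * winSlope a m i j).mulVec (b - a).ofLp) := by
  -- The tangent at `a` covers the half step to the midpoint `m`, the tangent at `m` the rest. One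
  -- factor 1/2 of the 1/4 is the length of the second half step, the other is the distance over
  -- which the score changes.
  have h1 := logLik_le w m b
  have h2 := logLik_le w a m
  have e1 : b - m = (1 / 2 : ℝ) • (b - a) := by
    rw [hm]; module
  have e2 : m - a = (1 / 2 : ℝ) • (b - a) := by
    rw [hm]; module
  have h3 := score_sub_score w a m
  rw [sub_eq_iff_eq_add] at h3
  rw [e1, h3, e2] at h1
  rw [e2] at h2
  simp only [WithLp.ofLp_smul, Matrix.mulVec_smul, dotProduct_smul, add_dotProduct,
    neg_dotProduct, smul_dotProduct, smul_eq_mul] at h1 h2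
  rw [dotProduct_comm (Matrix.mulVec _ _)] at h1
  linarith

/-! ### Deterministic limit theory along an arbitrary filter -/

section Limit

variable {n : ℕ} {ι : Type*} {l : Filter ι} {w : ι → Matrix (Fin n) (Fin n) ℕ} {S : ι → ℝ}
  {p : Fin n → Fin n → ℝ} {a : EuclideanSpace ℝ (Fin n)}

/-- The projection term vanishes on sum-zero vectors, so positive definiteness of the limit passes
to the Laplacians of the data with a uniform constant. -/
theorem eventually_coercive
    (hv : ∀ i j, Tendsto (fun x => (comparisonMatrix (w x) i j : ℝ) / S x) l (𝓝 (p i j)))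
    (hA : ∀ x : Fin n → ℝ, x ≠ 0 →
      0 < x ⬝ᵥ ((laplacian fun i j => p i j * winVar a i j) + avgMatrix n).mulVec x) :
    ∃ c : ℝ, 0 < c ∧ ∀ᶠ x in l, ∀ y : EuclideanSpace ℝ (Fin n), ∑ i, y i = 0 →
      c * ‖y‖ ^ 2 ≤ (1 / 2) * ∑ i, ∑ j, (comparisonMatrix (w x) i j : ℝ) / S x * winVar a i j *
        (y i - y j) ^ 2 := by
  obtain ⟨c, hc, h⟩ := eventually_le_dotProduct_mulVec hA
  refine ⟨c, hc, ?_⟩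
  have ht : Tendsto (fun x => (laplacian fun i j =>
      (comparisonMatrix (w x) i j : ℝ) / S x * winVar a i j) + avgMatrix n) l
      (𝓝 ((laplacian fun i j => p i j * winVar a i j) + avgMatrix n)) :=
    (tendsto_laplacian fun i j => (hv i j).mul_const _).add_const _
  filter_upwards [ht.eventually h] with x hx y hy
  have := hx y
  rwa [dotProduct_add_avgMatrix_mulVec _ hy, dotProduct_laplacian_mulVec] at this

/-- On a small sphere around `a` in the sum-zero hyperplane the likelihood loses a multiple of S r²,
while the linear term gains only o(S) r. Hence its maximum over the closed ball is interior and thus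
a critical point. -/
theorem eventually_exists_score_eq_zero (hS : ∀ᶠ x in l, 0 < S x) (ha : ∑ i, a i = 0)
    (hv : ∀ i j, Tendsto (fun x => (comparisonMatrix (w x) i j : ℝ) / S x) l (𝓝 (p i j)))
    (hs : ∀ k, Tendsto (fun x => score (w x) a k / S x) l (𝓝 0))
    (hA : ∀ x : Fin n → ℝ, x ≠ 0 →
      0 < x ⬝ᵥ ((laplacian fun i j => p i j * winVar a i j) + avgMatrix n).mulVec x)
    {ε : ℝ} (hε : 0 < ε) :
    ∀ᶠ x in l, ∃ b : EuclideanSpace ℝ (Fin n), ∑ i, b i = 0 ∧ ‖b - a‖ < ε ∧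
      score (w x) b = 0 := by
  obtain ⟨c, hc, hcoer⟩ := eventually_coercive hv hA
  obtain ⟨r, hr, hrε, hslope⟩ : ∃ r : ℝ, 0 < r ∧ r < ε ∧ ∀ b : EuclideanSpace ℝ (Fin n),
      ‖b - a‖ ≤ r → ∀ i j, winVar a i j / 2 ≤ winSlope a b i j := by
    have hev : ∀ᶠ b in 𝓝 a, ∀ i j, winVar a i j / 2 ≤ winSlope a b i j := by
      rw [eventually_all]; intro i
      rw [eventually_all]; intro j
      exact (tendsto_winSlope a i j).eventually_const_le (half_lt_self (winVar_pos a i j))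
    obtain ⟨δ, hδ, h⟩ := Metric.eventually_nhds_iff.1 hev
    refine ⟨min δ ε / 2, by positivity, ?_, fun b hb => h ?_⟩
    · linarith [min_le_right δ ε, lt_min hδ hε]
    · rw [dist_eq_norm]
      linarith [min_le_left δ ε, lt_min hδ hε]
  -- The 8 is the 4 of `logLik_le_quadratic` times the 2 lost by bounding `winSlope` below by
  -- `winVar / 2`.
  have hscore : ∀ᶠ x in l, ∑ k, |score (w x) a k / S x| < c * r / 8 := by
    have : Tendsto (fun x => ∑ k, |score (w x) a k / S x|) l (𝓝 (∑ _k : Fin n, |(0 : ℝ)|)) :=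
      tendsto_finsetSum _ fun k _ => (hs k).abs
    exact this.eventually_lt_const (by simp; positivity)
  filter_upwards [hS, hcoer, hscore] with x hSx hcx hsx
  set C : Set (EuclideanSpace ℝ (Fin n)) := {b | ∑ i, b i = 0} ∩ Metric.closedBall a r with hC
  have hCc : IsCompact C := by
    refine (isCompact_closedBall a r).inter_left ?_
    exact isClosed_eq (by fun_prop) continuous_const
  have haC : a ∈ C := ⟨ha, by simp [hr.le]⟩
  obtain ⟨b, hbC, hbmax⟩ := hCc.exists_isMaxOn ⟨a, haC⟩ (continuous_logLik (w x)).continuousOn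
  have hbr : ‖b - a‖ ≤ r := by simpa [dist_eq_norm] using hbC.2
  have hlt : ‖b - a‖ < r := by
    by_contra hnot
    have hreq : ‖b - a‖ = r := le_antisymm hbr (not_lt.1 hnot)
    set m := a + (1 / 2 : ℝ) • (b - a) with hm
    have hq := logLik_le_quadratic (w x) a b m hm
    have hmr : ‖m - a‖ ≤ r := by
      rw [hm, add_sub_cancel_left, norm_smul, hreq]
      norm_num
      linarith
    have h0 := hcx (b - a) (by
      have := hbC.1
      simp only [Set.mem_ofPred_eq] at this
      simp [Finset.sum_sub_distrib, this, ha])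
    rw [hreq] at h0
    have h1 : (1 / 2) * (S x * (c * r ^ 2)) ≤ (b - a).ofLp ⬝ᵥ (laplacian fun i j =>
        (comparisonMatrix (w x) i j : ℝ) * winSlope a m i j).mulVec (b - a).ofLp := by
      rw [dotProduct_laplacian_mulVec]
      calc (1 / 2) * (S x * (c * r ^ 2)) ≤ (1 / 2) * (S x * ((1 / 2) * ∑ i, ∑ j,
            (comparisonMatrix (w x) i j : ℝ) / S x * winVar a i j *
              ((b - a).ofLp i - (b - a).ofLp j) ^ 2)) := by gcongr
        _ = (1 / 2) * ∑ i, ∑ j, (comparisonMatrix (w x) i j : ℝ) * (winVar a i j / 2) *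
            ((b - a).ofLp i - (b - a).ofLp j) ^ 2 := by
          simp only [Finset.mul_sum]
          refine Finset.sum_congr rfl fun i _ => Finset.sum_congr rfl fun j _ => ?_
          field_simp
        _ ≤ _ := by
          gcongr with i _ j _
          exact hslope m hmr i j
    have h2 : score (w x) a ⬝ᵥ (b - a).ofLp < S x * (c * r ^ 2) / 8 := by
      have h3 := abs_dotProduct_le (score (w x) a) (b - a)
      rw [hreq] at h3
      have h4 : ∑ k, |score (w x) a k| = S x * ∑ k, |score (w x) a k / S x| := by
        rw [Finset.mul_sum]
        refine Finset.sum_congr rfl fun k _ => ?_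
        rw [abs_div, abs_of_pos hSx, mul_div_cancel₀ _ hSx.ne']
      rw [h4] at h3
      calc _ ≤ _ := h3
        _ < S x * (c * r / 8) * r := by gcongr
        _ = _ := by ring
    have h5 : logLik (w x) a ≤ logLik (w x) b := hbmax haC
    linarith
  refine ⟨b, hbC.1, hlt.trans hrε, score_eq_zero_of_isLocalMax ?_⟩
  -- Centering maps a full neighbourhood of `b` into the ball in the hyperplane and keeps the
  -- likelihood, so `b` is a local maximum in the whole space.
  have hb0 : centered b = b := centered_of_sum_eq_zero hbC.1
  have hnear : ∀ᶠ y in 𝓝 b, ‖centered y - a‖ < r := by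
    have : Continuous fun y : EuclideanSpace ℝ (Fin n) => ‖centered y - a‖ :=
      (continuous_centered.sub continuous_const).norm
    exact (this.tendsto b).eventually_lt_const (by rwa [hb0])
  filter_upwards [hnear] with y hy
  rw [← logLik_centered]
  exact hbmax ⟨sum_centered y, by simpa [dist_eq_norm] using hy.le⟩

/-- The maximum likelihood estimate exists, is unique and is consistent. -/
theorem eventually_isSumMLE (hS : ∀ᶠ x in l, 0 < S x) (ha : ∑ i, a i = 0)
    (hv : ∀ i j, Tendsto (fun x => (comparisonMatrix (w x) i j : ℝ) / S x) l (𝓝 (p i j)))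
    (hs : ∀ k, Tendsto (fun x => score (w x) a k / S x) l (𝓝 0))
    (hA : ∀ x : Fin n → ℝ, x ≠ 0 →
      0 < x ⬝ᵥ ((laplacian fun i j => p i j * winVar a i j) + avgMatrix n).mulVec x)
    {βhat : Matrix (Fin n) (Fin n) ℕ → EuclideanSpace ℝ (Fin n)}
    (hβhat : ∀ w : Matrix (Fin n) (Fin n) ℕ, (∃! b, IsSumMLE w b) → IsSumMLE w (βhat w)) :
    (∀ᶠ x in l, IsSumMLE (w x) (βhat (w x))) ∧ Tendsto (fun x => βhat (w x)) l (𝓝 a) := by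
  obtain ⟨c, hc, hcoer⟩ := eventually_coercive hv hA
  have key : ∀ ε > 0, ∀ᶠ x in l, IsSumMLE (w x) (βhat (w x)) ∧ ‖βhat (w x) - a‖ < ε := by
    intro ε hε
    filter_upwards [hcoer, eventually_exists_score_eq_zero hS ha hv hs hA hε] with x hcx
      ⟨b, hb, hba, hbs⟩
    -- Coercivity makes the observed comparison graph connected, which gives uniqueness.
    have hconn : ∀ y : Fin n → ℝ, ∑ i, y i = 0 →
        (∀ i j, (comparisonMatrix (w x) i j : ℝ) * (y i - y j) ^ 2 = 0) → y = 0 := by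
      intro y hy h
      have h1 := hcx (WithLp.toLp 2 y) hy
      have h2 : ∑ i, ∑ j, (comparisonMatrix (w x) i j : ℝ) / S x * winVar a i j *
          (y i - y j) ^ 2 = 0 := by
        refine Finset.sum_eq_zero fun i _ => Finset.sum_eq_zero fun j _ => ?_
        linear_combination (winVar a i j / S x) * h i j
      simp only [h2, mul_zero] at h1
      have h3 : ‖WithLp.toLp 2 y‖ ^ 2 = 0 :=
        le_antisymm (by nlinarith) (sq_nonneg _)
      have h4 : WithLp.toLp 2 y = 0 := by simpa using h3
      simpa using h4
    have hmle := isSumMLE_of_score_eq_zero hb hbs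
    have huniq : ∀ b', IsSumMLE (w x) b' → b' = b := fun b' hb' =>
      score_eq_zero_unique hconn hb hb'.1 hbs hb'.score_eq_zero
    have hhat := hβhat (w x) ⟨b, hmle, huniq⟩
    refine ⟨hhat, ?_⟩
    rwa [huniq _ hhat]
  refine ⟨(key 1 one_pos).mono fun x hx => hx.1, ?_⟩
  rw [Metric.tendsto_nhds]
  intro ε hε
  filter_upwards [key ε hε] with x hx
  rw [dist_eq_norm]
  exact hx.2

theorem tendsto_inv_matrix {A : Matrix (Fin n) (Fin n) ℝ} (hA : IsUnit A.det)
    {M : ι → Matrix (Fin n) (Fin n) ℝ} (hM : Tendsto M l (𝓝 A)) :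
    Tendsto (fun x => (M x)⁻¹) l (𝓝 A⁻¹) := by
  have hdet : Tendsto (fun x => (M x).det) l (𝓝 A.det) :=
    (Continuous.matrix_det continuous_id).tendsto A |>.comp hM
  have hadj : Tendsto (fun x => (M x).adjugate) l (𝓝 A.adjugate) :=
    (Continuous.matrix_adjugate continuous_id).tendsto A |>.comp hM
  simp only [Matrix.inv_def, Ring.inverse_eq_inv']
  exact (hdet.inv₀ hA.ne_zero).smul hadj

theorem eventually_isUnit_det {A : Matrix (Fin n) (Fin n) ℝ} (hA : IsUnit A.det)
    {M : ι → Matrix (Fin n) (Fin n) ℝ} (hM : Tendsto M l (𝓝 A)) :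
    ∀ᶠ x in l, IsUnit (M x).det := by
  have hdet : Tendsto (fun x => (M x).det) l (𝓝 A.det) :=
    (Continuous.matrix_det continuous_id).tendsto A |>.comp hM
  filter_upwards [hdet.eventually_ne hA.ne_zero] with x hx using isUnit_iff_ne_zero.2 hx

theorem tendsto_winVar {b : ι → EuclideanSpace ℝ (Fin n)} (hb : Tendsto b l (𝓝 a))
    (i j : Fin n) : Tendsto (fun x => winVar (b x) i j) l (𝓝 (winVar a i j)) := by
  have : Continuous fun b : EuclideanSpace ℝ (Fin n) => winVar b i j := by
    unfold winVar
    have h := continuous_sigmoid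
    fun_prop
  exact (this.tendsto a).comp hb

/-- The limit of the pseudoinverse of the Hessian at a consistent estimate. -/
theorem tendsto_neg_pseudoinverse_hessian (hS : ∀ᶠ x in l, 0 < S x)
    (hv : ∀ i j, Tendsto (fun x => (comparisonMatrix (w x) i j : ℝ) / S x) l (𝓝 (p i j)))
    (hA : ∀ x : Fin n → ℝ, x ≠ 0 →
      0 < x ⬝ᵥ ((laplacian fun i j => p i j * winVar a i j) + avgMatrix n).mulVec x)
    {b : ι → EuclideanSpace ℝ (Fin n)} (hb : Tendsto b l (𝓝 a)) {N : ι → ℝ} {κ : ℝ}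
    (hN : Tendsto (fun x => N x / S x) l (𝓝 κ)) :
    Tendsto (fun x => N x • -pseudoinverse (hessian (w x) (b x))) l
      (𝓝 (κ • pseudoinverse (laplacian fun i j => p i j * winVar a i j))) := by
  have hdet := isUnit_det_of_dotProduct_mulVec_pos hA
  have ht : Tendsto (fun x => (laplacian fun i j =>
      (comparisonMatrix (w x) i j : ℝ) / S x * winVar (b x) i j) + avgMatrix n) l
      (𝓝 ((laplacian fun i j => p i j * winVar a i j) + avgMatrix n)) :=
    (tendsto_laplacian fun i j => (hv i j).mul (tendsto_winVar hb i j)).add_const _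
  rw [pseudoinverse_eq_inv_sub (laplacian_mul_avgMatrix _) (avgMatrix_mul_laplacian _) hdet]
  -- The regularized matrices are eventually invertible, so the continuity of matrix inversion
  -- replaces that of the pseudoinverse.
  refine (hN.smul ((tendsto_inv_matrix hdet ht).sub_const (avgMatrix n))).congr' ?_
  filter_upwards [hS, eventually_isUnit_det hdet ht] with x hSx hx
  rw [← pseudoinverse_eq_inv_sub (laplacian_mul_avgMatrix _) (avgMatrix_mul_laplacian _) hx]
  have e : hessian (w x) (b x) = (-S x) • laplacian fun i j =>
      (comparisonMatrix (w x) i j : ℝ) / S x * winVar (b x) i j := by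
    rw [hessian_eq, ← neg_one_smul ℝ (laplacian _), ← laplacian_smul, ← laplacian_smul]
    congr 1
    ext i j
    field_simp
  rw [e, pseudoinverse_smul, inv_neg, neg_smul, neg_neg, smul_smul, div_eq_mul_inv]

/-- A consistent root of the score is asymptotically linear in the score at the limit. -/
theorem exists_tendsto_linearization (hS : ∀ᶠ x in l, 0 < S x) (ha : ∑ i, a i = 0)
    (hv : ∀ i j, Tendsto (fun x => (comparisonMatrix (w x) i j : ℝ) / S x) l (𝓝 (p i j)))
    (hA : ∀ x : Fin n → ℝ, x ≠ 0 →
      0 < x ⬝ᵥ ((laplacian fun i j => p i j * winVar a i j) + avgMatrix n).mulVec x)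
    {b : ι → EuclideanSpace ℝ (Fin n)} (hb : Tendsto b l (𝓝 a))
    (hmle : ∀ᶠ x in l, IsSumMLE (w x) (b x)) :
    ∃ B : ι → Matrix (Fin n) (Fin n) ℝ,
      Tendsto B l (𝓝 (pseudoinverse (laplacian fun i j => p i j * winVar a i j))) ∧
      ∀ᶠ x in l, S x • (b x - a).ofLp = (B x).mulVec (score (w x) a) := by
  have hdet := isUnit_det_of_dotProduct_mulVec_pos hA
  have ht : Tendsto (fun x => (laplacian fun i j =>
      (comparisonMatrix (w x) i j : ℝ) / S x * winSlope a (b x) i j) + avgMatrix n) l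
      (𝓝 ((laplacian fun i j => p i j * winVar a i j) + avgMatrix n)) :=
    (tendsto_laplacian fun i j => (hv i j).mul ((tendsto_winSlope a i j).comp hb)).add_const _
  rw [pseudoinverse_eq_inv_sub (laplacian_mul_avgMatrix _) (avgMatrix_mul_laplacian _) hdet]
  refine ⟨_, (tendsto_inv_matrix hdet ht).sub_const (avgMatrix n), ?_⟩
  filter_upwards [hS, eventually_isUnit_det hdet ht, hmle] with x hSx hx hm
  have h := score_sub_score (w x) a (b x)
  rw [hm.score_eq_zero, zero_sub, neg_inj] at h
  have e : (laplacian fun i j => (comparisonMatrix (w x) i j : ℝ) * winSlope a (b x) i j) =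
      S x • laplacian fun i j =>
        (comparisonMatrix (w x) i j : ℝ) / S x * winSlope a (b x) i j := by
    rw [← laplacian_smul]
    congr 1
    ext i j
    field_simp
  -- The score and the estimation error both have sum zero, so the projection can be added before
  -- inverting and subtracted afterwards at no cost.
  have hQ1 : (avgMatrix n).mulVec (score (w x) a) = 0 := by
    rw [avgMatrix_mulVec, sum_score]
    ext; simp
  have hQ2 : (avgMatrix n).mulVec (b x - a).ofLp = 0 := by
    have hs : ∑ i, (b x - a).ofLp i = 0 := by simp [Finset.sum_sub_distrib, hm.1, ha]
    rw [avgMatrix_mulVec, hs]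
    ext; simp
  have h2 : score (w x) a = ((laplacian fun i j =>
      (comparisonMatrix (w x) i j : ℝ) / S x * winSlope a (b x) i j) + avgMatrix n).mulVec
        (S x • (b x - a).ofLp) := by
    rw [h, e, Matrix.add_mulVec, Matrix.mulVec_smul, Matrix.mulVec_smul, hQ2, smul_zero,
      add_zero, Matrix.smul_mulVec]
  rw [Matrix.sub_mulVec, hQ1, sub_zero]
  conv_rhs => rw [h2]
  rw [Matrix.mulVec_mulVec, Matrix.nonsing_inv_mul _ hx, Matrix.one_mulVec]

end Limit

/-! ### Convergence in probability as convergence along a filter -/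

/-- The filter of the sets of pairs `(S, ω)` whose `S`-sections have probability tending to one.
Convergence in probability to a constant is convergence along this filter. -/
def probFilter {Ω : Type*} [MeasurableSpace Ω] (μ : Measure Ω) : Filter (ℕ × Ω) where
  sets := {A | Tendsto (fun S : ℕ => μ {ω | (S, ω) ∉ A}) atTop (𝓝 0)}
  univ_sets := by simp
  sets_of_superset {A B} hA hAB :=
    tendsto_of_tendsto_of_tendsto_of_le_of_le tendsto_const_nhds hA (fun _ => zero_le)
      fun _ => measure_mono fun _ hω hωA => hω (hAB hωA)
  inter_sets {A B} hA hB := by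
    have h := hA.add hB
    rw [add_zero] at h
    refine tendsto_of_tendsto_of_tendsto_of_le_of_le tendsto_const_nhds h (fun _ => zero_le)
      fun S => (measure_mono ?_).trans (measure_union_le _ _)
    intro ω hω
    by_contra hcon
    simp only [Set.mem_union, Set.mem_ofPred_eq, not_or, not_not] at hcon
    exact hω hcon

theorem eventually_probFilter {Ω : Type*} [MeasurableSpace Ω] {μ : Measure Ω}
    {p : ℕ × Ω → Prop} :
    (∀ᶠ x in probFilter μ, p x) ↔ Tendsto (fun S : ℕ => μ {ω | ¬ p (S, ω)}) atTop (𝓝 0) :=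
  Iff.rfl

theorem eventually_probFilter_fst {Ω : Type*} [MeasurableSpace Ω] {μ : Measure Ω}
    {p : ℕ → Prop} (h : ∀ᶠ S in atTop, p S) : ∀ᶠ x in probFilter μ, p x.1 := by
  rw [eventually_probFilter]
  refine tendsto_const_nhds.congr' ?_
  filter_upwards [h] with S hS
  simp [hS]

theorem tendstoInMeasure_const_iff {Ω E : Type*} [MeasurableSpace Ω] {μ : Measure Ω}
    [PseudoMetricSpace E] {f : ℕ → Ω → E} {c : E} :
    TendstoInMeasure μ f atTop (fun _ => c) ↔
      Tendsto (fun x : ℕ × Ω => f x.1 x.2) (probFilter μ) (𝓝 c) := by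
  rw [tendstoInMeasure_iff_dist, Metric.tendsto_nhds]
  refine forall₂_congr fun ε _ => ?_
  rw [eventually_probFilter]
  simp only [not_lt]

/-- The product of a sequence that tends to zero in probability and one that is bounded in
probability. -/
theorem tendsto_mul_probFilter {Ω : Type*} [MeasurableSpace Ω] {μ : Measure Ω}
    {g h : ℕ × Ω → ℝ} {C : ℝ} (hg : Tendsto g (probFilter μ) (𝓝 0))
    (hh : ∀ (M : ℝ), 0 < M → ∀ S, μ {ω | M ≤ |h (S, ω)|} ≤ ENNReal.ofReal (C / M ^ 2)) :
    Tendsto (fun x => g x * h x) (probFilter μ) (𝓝 0) := by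
  rw [Metric.tendsto_nhds]
  intro ε hε
  rw [eventually_probFilter, ENNReal.tendsto_nhds_zero]
  intro η hη
  -- The tail bound is uniform in `S`, so one cutoff `M` serves all sample sizes.
  obtain ⟨M, hM, hMη⟩ : ∃ M : ℝ, 0 < M ∧ ENNReal.ofReal (C / M ^ 2) ≤ η / 2 := by
    have ht : Tendsto (fun M : ℝ => ENNReal.ofReal (C / M ^ 2)) atTop (𝓝 0) := by
      rw [← ENNReal.ofReal_zero]
      exact ENNReal.tendsto_ofReal (tendsto_const_nhds.div_atTop (tendsto_pow_atTop two_ne_zero))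
    have := (ENNReal.tendsto_nhds_zero.1 ht) (η / 2) (ENNReal.half_pos hη.ne')
    obtain ⟨M, hM⟩ := (this.and (eventually_gt_atTop 0)).exists
    exact ⟨M, hM.2, hM.1⟩
  have hg' := (Metric.tendsto_nhds.1 hg) (ε / M) (by positivity)
  rw [eventually_probFilter, ENNReal.tendsto_nhds_zero] at hg'
  filter_upwards [hg' (η / 2) (ENNReal.half_pos hη.ne')] with S hS
  calc μ {ω | ¬ dist (g (S, ω) * h (S, ω)) 0 < ε}
      ≤ μ ({ω | ¬ dist (g (S, ω)) 0 < ε / M} ∪ {ω | M ≤ |h (S, ω)|}) := by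
        refine measure_mono fun ω hω => ?_
        by_contra hcon
        simp only [Set.mem_union, Set.mem_ofPred_eq, not_or, not_not, not_le,
          Real.dist_eq, sub_zero] at hcon
        refine hω ?_
        rw [Real.dist_eq, sub_zero, abs_mul]
        calc |g (S, ω)| * |h (S, ω)| ≤ |g (S, ω)| * M := by
              gcongr
              exact hcon.2.le
          _ < ε / M * M := by
              gcongr
              exact hcon.1
          _ = ε := by field_simp
    _ ≤ η / 2 + η / 2 := (measure_union_le _ _).trans (add_le_add hS ((hh M hM S).trans hMη))
    _ = η := ENNReal.add_halves η

/-! ### Limit theorems for independent, not identically distributed variables -/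

/-- Chebyshev's inequality: variances add by independence, and each is at most the second moment. -/
theorem measure_le_abs_sum_le {Ω : Type*} [MeasurableSpace Ω] {μ : Measure Ω}
    [IsProbabilityMeasure μ] {X : ℕ → Ω → ℝ} {m C : ℝ} (hX : iIndepFun X μ)
    (hL : ∀ s, MemLp (X s) 2 μ) (hm : ∀ s, ∫ ω, X s ω ∂μ = m)
    (hC : ∀ s, ∫ ω, X s ω ^ 2 ∂μ ≤ C) {M : ℝ} (hM : 0 < M) (S : ℕ) :
    μ {ω | M ≤ |∑ s ∈ Finset.range S, X s ω - S * m|} ≤ ENNReal.ofReal (S * C / M ^ 2) := by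
  have hsum : MemLp (∑ s ∈ Finset.range S, X s) 2 μ := memLp_finsetSum' _ fun s _ => hL s
  have hint : ∫ ω, (∑ s ∈ Finset.range S, X s) ω ∂μ = S * m := by
    simp only [Finset.sum_apply]
    rw [integral_finsetSum _ fun s _ => (hL s).integrable (by norm_num)]
    simp [hm]
  have h := meas_ge_le_variance_div_sq hsum hM
  rw [hint] at h
  simp only [Finset.sum_apply] at h
  refine h.trans (ENNReal.ofReal_le_ofReal ?_)
  gcongr
  rw [IndepFun.variance_sum (fun s _ => hL s) (fun i _ j _ hij => hX.indepFun hij)]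
  calc ∑ s ∈ Finset.range S, variance (X s) μ ≤ ∑ _s ∈ Finset.range S, C := by
        refine Finset.sum_le_sum fun s _ => (variance_le_expectation_sq ?_).trans (hC s)
        exact (hL s).aestronglyMeasurable
    _ = S * C := by simp

/-- The weak law of large numbers under bounded second moments. -/
theorem tendsto_sum_div_probFilter {Ω : Type*} [MeasurableSpace Ω] {μ : Measure Ω}
    [IsProbabilityMeasure μ] {X : ℕ → Ω → ℝ} {m C : ℝ} (hX : iIndepFun X μ)
    (hL : ∀ s, MemLp (X s) 2 μ) (hm : ∀ s, ∫ ω, X s ω ∂μ = m)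
    (hC : ∀ s, ∫ ω, X s ω ^ 2 ∂μ ≤ C) :
    Tendsto (fun x : ℕ × Ω => (∑ s ∈ Finset.range x.1, X s x.2) / x.1) (probFilter μ) (𝓝 m) := by
  rw [Metric.tendsto_nhds]
  intro ε hε
  rw [eventually_probFilter]
  have ht : Tendsto (fun S : ℕ => ENNReal.ofReal (C / ε ^ 2 / S)) atTop (𝓝 0) := by
    rw [← ENNReal.ofReal_zero]
    exact ENNReal.tendsto_ofReal (tendsto_const_div_atTop_nhds_zero_nat _)
  refine tendsto_of_tendsto_of_tendsto_of_le_of_le' tendsto_const_nhds ht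
    (Eventually.of_forall fun _ => zero_le) ?_
  filter_upwards [eventually_gt_atTop 0] with S hS
  have hS' : (0 : ℝ) < S := by exact_mod_cast hS
  calc _ ≤ μ {ω | ε * S ≤ |∑ s ∈ Finset.range S, X s ω - S * m|} := by
        refine measure_mono fun ω hω => ?_
        simp only [Set.mem_ofPred_eq, not_lt, Real.dist_eq] at hω ⊢
        calc ε * S ≤ |(∑ s ∈ Finset.range S, X s ω) / S - m| * S := by gcongr
          _ = |((∑ s ∈ Finset.range S, X s ω) / S - m) * S| := by
              rw [abs_mul, abs_of_pos hS']
          _ = _ := by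
              congr 1
              field_simp
    _ ≤ ENNReal.ofReal (S * C / (ε * S) ^ 2) :=
        measure_le_abs_sum_le hX hL hm hC (by positivity) S
    _ = _ := by
        congr 1
        field_simp

/-- Taylor's remainder is used for small `x`, the triangle inequality for large `x`. The minimum
lets the error be integrated with second moments only. -/
theorem norm_exp_mul_I_sub_le (x : ℝ) :
    ‖Complex.exp (x * Complex.I) - (1 + x * Complex.I - (x : ℂ) ^ 2 / 2)‖ ≤
      4 * (x ^ 2 * min |x| 1) := by
  rcases le_total |x| 1 with h | h
  · have hn : ‖(x : ℂ) * Complex.I‖ = |x| := by simp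
    have hb := Complex.exp_bound (x := x * Complex.I) (by rwa [hn]) (n := 3) (by norm_num)
    rw [hn] at hb
    have e : ∑ m ∈ Finset.range 3, ((x : ℂ) * Complex.I) ^ m / (m.factorial : ℂ) =
        1 + x * Complex.I - (x : ℂ) ^ 2 / 2 := by
      simp [Finset.sum_range_succ, mul_pow, Nat.factorial]
      ring
    rw [e] at hb
    rw [min_eq_left h]
    calc _ ≤ _ := hb
      _ ≤ |x| ^ 3 * 4 := by
          gcongr
          norm_num [Nat.factorial]
      _ = 4 * (x ^ 2 * |x|) := by rw [← sq_abs x]; ring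
  · rw [min_eq_right h]
    have h1 : ‖Complex.exp (x * Complex.I)‖ = 1 := Complex.norm_exp_ofReal_mul_I x
    have h2 : ‖(1 : ℂ) + x * Complex.I - (x : ℂ) ^ 2 / 2‖ ≤ 1 + |x| + x ^ 2 / 2 := by
      refine (norm_sub_le _ _).trans (add_le_add ((norm_add_le _ _).trans ?_) ?_)
      · simp
      · simp
    have h3 := norm_sub_le (Complex.exp (x * Complex.I)) (1 + x * Complex.I - (x : ℂ) ^ 2 / 2)
    have h4 : |x| ≤ x ^ 2 := by
      rw [← sq_abs x]; nlinarith
    nlinarith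

/-- Telescoping: the factors are exchanged one at a time, and the remaining ones have norm at most
one. -/
theorem norm_prod_sub_prod_le {ι : Type*} (s : Finset ι) (a b : ι → ℂ)
    (ha : ∀ i ∈ s, ‖a i‖ ≤ 1) (hb : ∀ i ∈ s, ‖b i‖ ≤ 1) :
    ‖∏ i ∈ s, a i - ∏ i ∈ s, b i‖ ≤ ∑ i ∈ s, ‖a i - b i‖ := by
  classical
  induction s using Finset.induction_on with
  | empty => simp
  | insert i s hi ih =>
    rw [Finset.prod_insert hi, Finset.prod_insert hi, Finset.sum_insert hi]
    have ha' := fun j hj => ha j (Finset.mem_insert_of_mem hj)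
    have hb' := fun j hj => hb j (Finset.mem_insert_of_mem hj)
    have hpa : ‖∏ j ∈ s, a j‖ ≤ 1 := by
      rw [norm_prod]
      exact Finset.prod_le_one (fun _ _ => norm_nonneg _) ha'
    have hbi := hb i (Finset.mem_insert_self i s)
    calc ‖a i * ∏ j ∈ s, a j - b i * ∏ j ∈ s, b j‖
        = ‖(a i - b i) * ∏ j ∈ s, a j + b i * (∏ j ∈ s, a j - ∏ j ∈ s, b j)‖ := by
          congr 1; ring
      _ ≤ ‖a i - b i‖ * ‖∏ j ∈ s, a j‖ + ‖b i‖ * ‖∏ j ∈ s, a j - ∏ j ∈ s, b j‖ := by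
          refine (norm_add_le _ _).trans ?_
          rw [norm_mul, norm_mul]
      _ ≤ ‖a i - b i‖ * 1 + 1 * ∑ j ∈ s, ‖a j - b j‖ := by
          gcongr
          exact ih ha' hb'
      _ = _ := by ring

/-- The error is expressed through the dominating variable alone. When the dominators share a law,
it is therefore uniform over summands whose own laws differ. -/
theorem norm_charFun_sub_le {Ω : Type*} [MeasurableSpace Ω] {μ : Measure Ω}
    [IsProbabilityMeasure μ] {X Y : Ω → ℝ} (hXm : Measurable X) (hY : MemLp Y 2 μ)
    (hXY : ∀ ω, |X ω| ≤ Y ω) (h0 : ∫ ω, X ω ∂μ = 0) (t : ℝ) :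
    ‖charFun (μ.map X) t - (1 - ((t ^ 2 * ∫ ω, X ω ^ 2 ∂μ : ℝ) : ℂ) / 2)‖ ≤
      4 * t ^ 2 * ∫ ω, Y ω ^ 2 * min (|t| * Y ω) 1 ∂μ := by
  have hXL : MemLp X 2 μ := hY.mono hXm.aestronglyMeasurable (Eventually.of_forall fun ω => by
    rw [Real.norm_eq_abs, Real.norm_eq_abs]
    exact (hXY ω).trans (le_abs_self _))
  have hXi : Integrable X μ := hXL.integrable (by norm_num)
  have hX2 : Integrable (fun ω => X ω ^ 2) μ := hXL.integrable_sq
  have hexp : Integrable (fun ω => Complex.exp ((t * X ω : ℝ) * Complex.I)) μ := by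
    refine Integrable.of_bound (C := 1) ?_ (Eventually.of_forall fun ω => ?_)
    · exact (by fun_prop : Measurable fun ω =>
        Complex.exp ((t * X ω : ℝ) * Complex.I)).aestronglyMeasurable
    · rw [Complex.norm_exp_ofReal_mul_I]
  have hchar : charFun (μ.map X) t = ∫ ω, Complex.exp ((t * X ω : ℝ) * Complex.I) ∂μ := by
    rw [charFun_apply_real, integral_map hXm.aemeasurable]
    · simp
    · exact (by fun_prop : Measurable fun x : ℝ =>
        Complex.exp (t * x * Complex.I)).aestronglyMeasurable
  have hi1 : Integrable (fun ω => ((t * X ω : ℝ) : ℂ) * Complex.I) μ :=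
    ((hXi.const_mul t).ofReal).mul_const _
  have hi2 : Integrable (fun ω => ((t * X ω : ℝ) : ℂ) ^ 2 / 2) μ := by
    have : Integrable (fun ω => (((t ^ 2 * X ω ^ 2 : ℝ)) : ℂ)) μ := (hX2.const_mul (t ^ 2)).ofReal
    refine (this.div_const 2).congr (Eventually.of_forall fun ω => ?_)
    simp [mul_pow]
  have hi01 : Integrable (fun ω => 1 + ((t * X ω : ℝ) : ℂ) * Complex.I) μ :=
    (integrable_const _).add hi1
  have hi012 : Integrable
      (fun ω => 1 + ((t * X ω : ℝ) : ℂ) * Complex.I - ((t * X ω : ℝ) : ℂ) ^ 2 / 2) μ :=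
    hi01.sub hi2
  have hpoly : ∫ ω, (1 + ((t * X ω : ℝ) : ℂ) * Complex.I - ((t * X ω : ℝ) : ℂ) ^ 2 / 2) ∂μ =
      1 - ((t ^ 2 * ∫ ω, X ω ^ 2 ∂μ : ℝ) : ℂ) / 2 := by
    rw [integral_sub hi01 hi2, integral_add (integrable_const _) hi1,
      integral_mul_const, integral_div]
    have e1 : ∫ ω, ((t * X ω : ℝ) : ℂ) ∂μ = 0 := by
      rw [integral_complex_ofReal, integral_const_mul, h0]; simp
    have e2 : ∫ ω, ((t * X ω : ℝ) : ℂ) ^ 2 ∂μ = ((t ^ 2 * ∫ ω, X ω ^ 2 ∂μ : ℝ) : ℂ) := by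
      rw [← integral_const_mul, ← integral_complex_ofReal]
      refine integral_congr_ae (Eventually.of_forall fun ω => ?_)
      simp [mul_pow]
    rw [e1, e2]
    simp
  have hYnn : ∀ ω, 0 ≤ Y ω := fun ω => (abs_nonneg _).trans (hXY ω)
  have hbound : Integrable (fun ω => Y ω ^ 2 * min (|t| * Y ω) 1) μ := by
    refine hY.integrable_sq.mono ?_ (Eventually.of_forall fun ω => ?_)
    · exact (hY.aestronglyMeasurable.pow 2).mul
        ((hY.aestronglyMeasurable.const_mul _).inf aestronglyMeasurable_const)
    · have hmin : 0 ≤ min (|t| * Y ω) 1 := le_min (mul_nonneg (abs_nonneg _) (hYnn ω)) zero_le_one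
      rw [norm_mul, Real.norm_of_nonneg hmin]
      exact mul_le_of_le_one_right (norm_nonneg _) (min_le_right _ _)
  rw [hchar, ← hpoly, ← integral_sub hexp hi012,
    ← integral_const_mul]
  refine norm_integral_le_of_norm_le (hbound.const_mul _) (Eventually.of_forall fun ω => ?_)
  refine (norm_exp_mul_I_sub_le (t * X ω)).trans ?_
  have h1 : (t * X ω) ^ 2 ≤ t ^ 2 * Y ω ^ 2 := by
    rw [mul_pow]
    exact mul_le_mul_of_nonneg_left
      (sq_le_sq' (abs_le.1 (hXY ω)).1 (abs_le.1 (hXY ω)).2) (sq_nonneg t)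
  have h2 : min |t * X ω| 1 ≤ min (|t| * Y ω) 1 := by
    rw [abs_mul]
    gcongr
    exact hXY ω
  calc 4 * ((t * X ω) ^ 2 * min |t * X ω| 1)
      ≤ 4 * ((t ^ 2 * Y ω ^ 2) * min (|t| * Y ω) 1) := by gcongr
    _ = _ := by ring

/-- The central limit theorem for independent centered variables with the same variance that are
dominated by identically distributed square integrable ones. -/
theorem tendsto_charFun_sum_of_dominated {Ω : Type*} [MeasurableSpace Ω] {μ : Measure Ω}
    [IsProbabilityMeasure μ] {X Y : ℕ → Ω → ℝ} {τ : ℝ} (hX : iIndepFun X μ)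
    (hXm : ∀ s, Measurable (X s)) (hY : MemLp (Y 0) 2 μ)
    (hYid : ∀ s, IdentDistrib (Y s) (Y 0) μ μ) (hXY : ∀ s ω, |X s ω| ≤ Y s ω)
    (h0 : ∀ s, ∫ ω, X s ω ∂μ = 0) (hτ : ∀ s, ∫ ω, X s ω ^ 2 ∂μ = τ) :
    Tendsto (fun S : ℕ => charFun (μ.map fun ω => ∑ s ∈ Finset.range S, X s ω) (√S)⁻¹) atTop
      (𝓝 (Complex.exp (-(τ : ℂ) / 2))) := by
  have hτ0 : 0 ≤ τ := by
    rw [← hτ 0]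
    exact integral_nonneg fun ω => sq_nonneg _
  have hYnn : ∀ ω, 0 ≤ Y 0 ω := fun ω => (abs_nonneg _).trans (hXY 0 ω)
  have hpow : Tendsto (fun S : ℕ => (1 + (-(τ : ℂ) / 2) / S) ^ S) atTop
      (𝓝 (Complex.exp (-(τ : ℂ) / 2))) := Complex.tendsto_one_add_div_pow_exp _
  have hinv : Tendsto (fun S : ℕ => (√(S : ℝ))⁻¹) atTop (𝓝 0) :=
    tendsto_inv_atTop_zero.comp (Real.tendsto_sqrt_atTop.comp tendsto_natCast_atTop_atTop)
  -- This is the Lindeberg-type condition: it bounds the total error of the `S` factors, each of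
  -- which carries a weight 1/S.
  have hdct : Tendsto (fun S : ℕ => 4 * ∫ ω, Y 0 ω ^ 2 * min (|(√(S : ℝ))⁻¹| * Y 0 ω) 1 ∂μ)
      atTop (𝓝 0) := by
    have h : Tendsto (fun S : ℕ => ∫ ω, Y 0 ω ^ 2 * min (|(√(S : ℝ))⁻¹| * Y 0 ω) 1 ∂μ)
        atTop (𝓝 (∫ _ω, (0 : ℝ) ∂μ)) := by
      refine tendsto_integral_of_dominated_convergence (fun ω => Y 0 ω ^ 2) ?_ hY.integrable_sq
        ?_ ?_
      · intro S
        exact (hY.aestronglyMeasurable.pow 2).mul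
          ((hY.aestronglyMeasurable.const_mul _).inf aestronglyMeasurable_const)
      · intro S
        refine Eventually.of_forall fun ω => ?_
        have hmin : 0 ≤ min (|(√(S : ℝ))⁻¹| * Y 0 ω) 1 :=
          le_min (mul_nonneg (abs_nonneg _) (hYnn ω)) zero_le_one
        rw [norm_mul, Real.norm_of_nonneg hmin, Real.norm_of_nonneg (sq_nonneg _)]
        exact mul_le_of_le_one_right (sq_nonneg _) (min_le_right _ _)
      · refine Eventually.of_forall fun ω => ?_
        have h1 : Tendsto (fun S : ℕ => min (|(√(S : ℝ))⁻¹| * Y 0 ω) 1) atTop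
            (𝓝 (min (|0| * Y 0 ω) 1)) := (hinv.abs.mul_const _).min tendsto_const_nhds
        simpa using h1.const_mul (Y 0 ω ^ 2)
    simpa using h.const_mul 4
  refine hpow.congr_dist ?_
  refine squeeze_zero' (Eventually.of_forall fun _ => dist_nonneg) ?_ hdct
  -- `S ≥ τ` keeps the factor 1 - τ/(2S) in the unit disc, as the product comparison requires.
  filter_upwards [eventually_gt_atTop 0, eventually_ge_atTop ⌈τ⌉₊] with S hS hSτ
  have hS' : (0 : ℝ) < S := by exact_mod_cast hS
  have hSτ' : τ ≤ S := Nat.ceil_le.1 hSτ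
  have hsq : (√(S : ℝ))⁻¹ ^ 2 = (S : ℝ)⁻¹ := by
    rw [inv_pow, Real.sq_sqrt hS'.le]
  have hprod : charFun (μ.map fun ω => ∑ s ∈ Finset.range S, X s ω) (√(S : ℝ))⁻¹ =
      ∏ s ∈ Finset.range S, charFun (μ.map (X s)) (√(S : ℝ))⁻¹ := by
    rw [(hX.restrict _).charFun_map_fun_finsetSum_eq_prod fun s _ => (hXm s).aemeasurable]
    simp
  have hb : ‖(1 : ℂ) + (-(τ : ℂ) / 2) / S‖ ≤ 1 := by
    have e : (1 : ℂ) + (-(τ : ℂ) / 2) / S = ((1 - τ / (2 * S) : ℝ) : ℂ) := by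
      push_cast
      field_simp
      ring
    rw [e, Complex.norm_real, Real.norm_eq_abs, abs_le]
    have h1 : τ / (2 * S) ≤ 1 := by
      rw [div_le_one (by positivity)]; linarith
    have h2 : 0 ≤ τ / (2 * S) := by positivity
    constructor <;> linarith
  have hpr : ∀ s, IsProbabilityMeasure (μ.map (X s)) := fun s =>
    Measure.isProbabilityMeasure_map (hXm s).aemeasurable
  rw [dist_comm, dist_eq_norm, hprod]
  have hc : (1 + (-(τ : ℂ) / 2) / S) ^ S =
      ∏ _s ∈ Finset.range S, (1 + (-(τ : ℂ) / 2) / S) := by simp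
  rw [hc]
  refine (norm_prod_sub_prod_le _ _ _ (fun s _ => norm_charFun_le_one _) fun s _ => hb).trans ?_
  calc ∑ s ∈ Finset.range S, ‖charFun (μ.map (X s)) (√(S : ℝ))⁻¹ - (1 + (-(τ : ℂ) / 2) / S)‖
      ≤ ∑ _s ∈ Finset.range S, 4 * (S : ℝ)⁻¹ *
          ∫ ω, Y 0 ω ^ 2 * min (|(√(S : ℝ))⁻¹| * Y 0 ω) 1 ∂μ := by
        refine Finset.sum_le_sum fun s _ => ?_
        have h := norm_charFun_sub_le (hXm s) ((hYid s).symm.memLp_snd hY) (hXY s) (h0 s)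
          (√(S : ℝ))⁻¹
        rw [hτ s, hsq] at h
        have e : (1 : ℂ) - (((S : ℝ)⁻¹ * τ : ℝ) : ℂ) / 2 = 1 + (-(τ : ℂ) / 2) / S := by
          push_cast
          field_simp
          ring
        rw [e] at h
        have hid : ∫ ω, Y s ω ^ 2 * min (|(√(S : ℝ))⁻¹| * Y s ω) 1 ∂μ =
            ∫ ω, Y 0 ω ^ 2 * min (|(√(S : ℝ))⁻¹| * Y 0 ω) 1 ∂μ :=
          ((hYid s).comp (u := fun y : ℝ => y ^ 2 * min (|(√(S : ℝ))⁻¹| * y) 1)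
            (by fun_prop)).integral_eq
        rwa [hid] at h
    _ = _ := by
        rw [Finset.sum_const, Finset.card_range, nsmul_eq_mul]
        generalize ∫ ω, Y 0 ω ^ 2 * min (|(√(S : ℝ))⁻¹| * Y 0 ω) 1 ∂μ = J
        field_simp

/-! ### Moments of the score under the Bradley–Terry model -/

instance instDiscreteMeasurableSpaceNatMatrix {n : ℕ} :
    DiscreteMeasurableSpace (Matrix (Fin n) (Fin n) ℕ) := ⟨fun _ => trivial⟩

instance instCountableNatMatrix {n : ℕ} : Countable (Matrix (Fin n) (Fin n) ℕ) :=
  inferInstanceAs (Countable (Fin n → Fin n → ℕ))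

/-- The unordered pairs of distinct objects. -/
abbrev ObjPair (n : ℕ) : Type := {e : Fin n × Fin n // e.1 < e.2}

theorem prod_Ioi_eq_prod_objPair {n : ℕ} {M : Type*} [CommMonoid M] (f : Fin n → Fin n → M) :
    ∏ i, ∏ j ∈ Finset.Ioi i, f i j = ∏ e : ObjPair n, f e.1.1 e.1.2 := by
  rw [← Finset.prod_subtype (Finset.univ.filter fun e : Fin n × Fin n => e.1 < e.2)
    (by simp) (fun e => f e.1 e.2), Finset.prod_filter, Fintype.prod_prod_type]
  refine Finset.prod_congr rfl fun i _ => ?_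
  rw [← Finset.prod_filter]
  refine Finset.prod_congr ?_ fun _ _ => rfl
  ext j; simp

theorem sum_Ioi_eq_sum_objPair {n : ℕ} {M : Type*} [AddCommMonoid M] (f : Fin n → Fin n → M) :
    ∑ i, ∑ j ∈ Finset.Ioi i, f i j = ∑ e : ObjPair n, f e.1.1 e.1.2 := by
  rw [← Finset.sum_subtype (Finset.univ.filter fun e : Fin n × Fin n => e.1 < e.2)
    (by simp) (fun e => f e.1 e.2), Finset.sum_filter, Fintype.sum_prod_type]
  refine Finset.sum_congr rfl fun i _ => ?_
  rw [← Finset.sum_filter]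
  refine Finset.sum_congr ?_ fun _ _ => rfl
  ext j; simp

theorem sum_sum_eq_sum_objPair {n : ℕ} {M : Type*} [AddCommMonoid M] (f : Fin n → Fin n → M)
    (hf : ∀ i, f i i = 0) :
    ∑ i, ∑ j, f i j = ∑ e : ObjPair n, (f e.1.1 e.1.2 + f e.1.2 e.1.1) := by
  have h : ∀ g : Fin n → Fin n → M, ∑ i, ∑ j ∈ Finset.Ioi i, g i j =
      ∑ i, ∑ j, if i < j then g i j else 0 := by
    intro g
    refine Finset.sum_congr rfl fun i _ => ?_
    rw [← Finset.sum_filter]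
    refine Finset.sum_congr ?_ fun _ _ => rfl
    ext j; simp
  rw [← sum_Ioi_eq_sum_objPair fun i j => f i j + f j i]
  simp only [Finset.sum_add_distrib]
  rw [h f, h fun i j => f j i, Finset.sum_comm (f := fun i j => if i < j then f j i else 0)]
  simp only [← Finset.sum_add_distrib]
  refine Finset.sum_congr rfl fun i _ => Finset.sum_congr rfl fun j _ => ?_
  rcases lt_trichotomy i j with h | h | h
  · simp [h, h.not_gt]
  · simp [h, hf]
  · simp [h, h.not_gt]

/-! ### Moments of sums of independent coordinates under finite product weights -/

section ProductSums

variable {ι : Type*} [Fintype ι] [DecidableEq ι] {s : ι → Finset ℕ} {p x : ι → ℕ → ℝ}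

theorem sum_piFinset_prod_mul
    (hx : ∀ e, ∑ k ∈ s e, p e k * x e k = 0) (a : ι) :
    ∑ k ∈ Fintype.piFinset s, (∏ e, p e (k e)) * x a (k a) = 0 := by
  have h : ∀ k ∈ Fintype.piFinset s, (∏ e, p e (k e)) * x a (k a) =
      ∏ e, p e (k e) * (if e = a then x e (k e) else 1) := by
    intro k _
    rw [Finset.prod_mul_distrib, Finset.prod_ite_eq' Finset.univ a]
    simp
  rw [Finset.sum_congr rfl h,
    ← Finset.prod_univ_sum s fun e k => p e k * (if e = a then x e k else 1)]
  exact Finset.prod_eq_zero (Finset.mem_univ a) (by simpa using hx a)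

/-- Inserting trivial factors turns the summand into a product over coordinates, so the sum
factorizes; off the diagonal one factor is a vanishing mean. -/
theorem sum_piFinset_prod_mul_mul {τ : ι → ℝ} (hp : ∀ e, ∑ k ∈ s e, p e k = 1)
    (hx : ∀ e, ∑ k ∈ s e, p e k * x e k = 0) (hτ : ∀ e, ∑ k ∈ s e, p e k * x e k ^ 2 = τ e)
    (a b : ι) :
    ∑ k ∈ Fintype.piFinset s, (∏ e, p e (k e)) * (x a (k a) * x b (k b)) =
      if a = b then τ a else 0 := by
  have h : ∀ k ∈ Fintype.piFinset s, (∏ e, p e (k e)) * (x a (k a) * x b (k b)) =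
      ∏ e, p e (k e) * ((if e = a then x e (k e) else 1) * (if e = b then x e (k e) else 1)) := by
    intro k _
    rw [Finset.prod_mul_distrib, Finset.prod_mul_distrib, Finset.prod_ite_eq' Finset.univ a,
      Finset.prod_ite_eq' Finset.univ b]
    simp
  rw [Finset.sum_congr rfl h, ← Finset.prod_univ_sum s
    fun e k => p e k * ((if e = a then x e k else 1) * (if e = b then x e k else 1))]
  split_ifs with hab
  · subst hab
    rw [Finset.prod_eq_single a]
    · rw [← hτ a]
      exact Finset.sum_congr rfl fun k _ => by simp [sq]
    · intro e _ hea
      simpa [hea] using hp e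
    · simp
  · refine Finset.prod_eq_zero (Finset.mem_univ a) ?_
    simpa [hab] using hx a

theorem sum_piFinset_prod_mul_sum
    (hx : ∀ e, ∑ k ∈ s e, p e k * x e k = 0) :
    ∑ k ∈ Fintype.piFinset s, (∏ e, p e (k e)) * ∑ e, x e (k e) = 0 := by
  simp only [Finset.mul_sum]
  rw [Finset.sum_comm]
  exact Finset.sum_eq_zero fun a _ => sum_piFinset_prod_mul hx a

theorem sum_piFinset_prod_mul_sum_sq {τ : ι → ℝ} (hp : ∀ e, ∑ k ∈ s e, p e k = 1)
    (hx : ∀ e, ∑ k ∈ s e, p e k * x e k = 0) (hτ : ∀ e, ∑ k ∈ s e, p e k * x e k ^ 2 = τ e) :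
    ∑ k ∈ Fintype.piFinset s, (∏ e, p e (k e)) * (∑ e, x e (k e)) ^ 2 = ∑ e, τ e := by
  have h : ∀ k ∈ Fintype.piFinset s, (∏ e, p e (k e)) * (∑ e, x e (k e)) ^ 2 =
      ∑ a, ∑ c, (∏ e, p e (k e)) * (x a (k a) * x c (k c)) := by
    intro k _
    rw [sq, Finset.sum_mul_sum, Finset.mul_sum]
    exact Finset.sum_congr rfl fun a _ => Finset.mul_sum _ _ _
  rw [Finset.sum_congr rfl h, Finset.sum_comm]
  refine Finset.sum_congr rfl fun a _ => ?_
  rw [Finset.sum_comm]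
  rw [Finset.sum_congr rfl fun b _ => sum_piFinset_prod_mul_mul hp hx hτ a b]
  simp

end ProductSums

/-- The weights of the binomial distribution. -/
noncomputable def binomialWeight (N : ℕ) (q : ℝ) (k : ℕ) : ℝ :=
  (N.choose k : ℝ) * q ^ k * (1 - q) ^ (N - k)

theorem eval_bernsteinPolynomial (N : ℕ) (q : ℝ) (k : ℕ) :
    (bernsteinPolynomial ℝ N k).eval q = binomialWeight N q k := by
  simp [bernsteinPolynomial, binomialWeight]

/-- The binomial mass, mean and variance are the classical identities for Bernstein polynomials,
evaluated at `q`. -/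
theorem sum_binomialWeight (N : ℕ) (q : ℝ) :
    ∑ k ∈ Finset.range (N + 1), binomialWeight N q k = 1 := by
  have h := congrArg (Polynomial.eval q) (bernsteinPolynomial.sum ℝ N)
  simpa [Polynomial.eval_finsetSum, eval_bernsteinPolynomial] using h

theorem sum_binomialWeight_mul (N : ℕ) (q : ℝ) :
    ∑ k ∈ Finset.range (N + 1), binomialWeight N q k * (k - N * q) = 0 := by
  have h := congrArg (Polynomial.eval q) (bernsteinPolynomial.sum_smul ℝ N)
  simp only [Polynomial.eval_finsetSum, nsmul_eq_mul, Polynomial.eval_mul,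
    Polynomial.eval_natCast, eval_bernsteinPolynomial, Polynomial.eval_X] at h
  simp only [mul_sub, Finset.sum_sub_distrib, ← Finset.sum_mul, sum_binomialWeight]
  rw [Finset.sum_congr rfl fun k _ => mul_comm _ _, h]
  ring

theorem sum_binomialWeight_mul_sq (N : ℕ) (q : ℝ) :
    ∑ k ∈ Finset.range (N + 1), binomialWeight N q k * (k - N * q) ^ 2 =
      N * (q * (1 - q)) := by
  have h := congrArg (Polynomial.eval q) (bernsteinPolynomial.variance ℝ N)
  simp only [Polynomial.eval_finsetSum, nsmul_eq_mul, Polynomial.eval_mul, Polynomial.eval_pow,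
    Polynomial.eval_sub, Polynomial.eval_one,
    Polynomial.eval_natCast, eval_bernsteinPolynomial, Polynomial.eval_X] at h
  rw [← mul_assoc, ← h]
  exact Finset.sum_congr rfl fun k _ => by ring

/-- The contingency matrix with comparison matrix `v` in which the smaller object of the pair `e`
wins `k e` times. -/
def ofWins {n : ℕ} (v : Matrix (Fin n) (Fin n) ℕ) (k : ObjPair n → ℕ) :
    Matrix (Fin n) (Fin n) ℕ :=
  Matrix.of fun i j => if h : i < j then k ⟨(i, j), h⟩ else
    if h : j < i then v j i - k ⟨(j, i), h⟩ else 0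

theorem ofWins_lt {n : ℕ} (v : Matrix (Fin n) (Fin n) ℕ) (k : ObjPair n → ℕ) (e : ObjPair n) :
    ofWins v k e.1.1 e.1.2 = k e := by
  simp [ofWins, e.2]

theorem ofWins_gt {n : ℕ} (v : Matrix (Fin n) (Fin n) ℕ) (k : ObjPair n → ℕ) (e : ObjPair n) :
    ofWins v k e.1.2 e.1.1 = v e.1.1 e.1.2 - k e := by
  simp [ofWins, e.2, e.2.not_gt]

theorem ofWins_self {n : ℕ} (v : Matrix (Fin n) (Fin n) ℕ) (k : ObjPair n → ℕ) (i : Fin n) :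
    ofWins v k i i = 0 := by
  simp [ofWins]

theorem comparisonMatrix_apply {n : ℕ} (w : Matrix (Fin n) (Fin n) ℕ) (i j : Fin n) :
    comparisonMatrix w i j = w i j + w j i := rfl

theorem ofWins_comparisonMatrix {n : ℕ} {w : Matrix (Fin n) (Fin n) ℕ} (hw : ∀ i, w i i = 0) :
    ofWins (comparisonMatrix w) (fun e => w e.1.1 e.1.2) = w := by
  ext i j
  rcases lt_trichotomy i j with h | h | h
  · simp [ofWins, h]
  · subst h; simp [ofWins, hw]
  · simp [ofWins, h, h.not_gt, comparisonMatrix_apply]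

/-- The bound on `k` makes the truncated subtraction in `ofWins` exact. -/
theorem comparisonMatrix_ofWins {n : ℕ} {w : Matrix (Fin n) (Fin n) ℕ} (hw : ∀ i, w i i = 0)
    {k : ObjPair n → ℕ} (hk : ∀ e, k e ≤ comparisonMatrix w e.1.1 e.1.2) :
    comparisonMatrix (ofWins (comparisonMatrix w) k) = comparisonMatrix w := by
  have key : ∀ e : ObjPair n, comparisonMatrix (ofWins (comparisonMatrix w) k) e.1.1 e.1.2 =
      comparisonMatrix w e.1.1 e.1.2 := fun e => by
    rw [comparisonMatrix_apply, ofWins_lt, ofWins_gt]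
    have := hk e
    omega
  ext i j
  rcases lt_trichotomy i j with h | h | h
  · exact key ⟨(i, j), h⟩
  · subst h
    rw [comparisonMatrix_apply, comparisonMatrix_apply, ofWins_self, hw]
  · have := key ⟨(j, i), h⟩
    rw [comparisonMatrix_apply, comparisonMatrix_apply] at this ⊢
    simp only at this
    omega

theorem outcomeProb_ofWins {n : ℕ} (b : EuclideanSpace ℝ (Fin n))
    {w : Matrix (Fin n) (Fin n) ℕ} (hw : ∀ i, w i i = 0)
    {k : ObjPair n → ℕ} (hk : ∀ e, k e ≤ comparisonMatrix w e.1.1 e.1.2) :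
    outcomeProb b (ofWins (comparisonMatrix w) k) = ∏ e : ObjPair n,
      binomialWeight (comparisonMatrix w e.1.1 e.1.2) (Real.sigmoid (b e.1.1 - b e.1.2))
        (k e) := by
  rw [outcomeProb, prod_Ioi_eq_prod_objPair fun i j =>
    ((comparisonMatrix (ofWins (comparisonMatrix w) k) i j).choose
      (ofWins (comparisonMatrix w) k i j) : ℝ) *
    Real.sigmoid (b i - b j) ^ ofWins (comparisonMatrix w) k i j *
    Real.sigmoid (b j - b i) ^ ofWins (comparisonMatrix w) k j i]
  refine Finset.prod_congr rfl fun e _ => ?_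
  rw [comparisonMatrix_ofWins hw hk, ofWins_lt, ofWins_gt, binomialWeight,
    sigmoid_sub_swap (b e.1.1) (b e.1.2)]

/-- Writes the score as a combination of win counts centered at their binomial means, one for each
unordered pair. -/
theorem score_dotProduct_eq_sum_objPair {n : ℕ} (w : Matrix (Fin n) (Fin n) ℕ)
    (b : EuclideanSpace ℝ (Fin n)) (t : Fin n → ℝ) :
    score w b ⬝ᵥ t = ∑ e : ObjPair n, (t e.1.1 - t e.1.2) * ((w e.1.1 e.1.2 : ℝ) -
      (comparisonMatrix w e.1.1 e.1.2 : ℝ) * Real.sigmoid (b e.1.1 - b e.1.2)) := by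
  rw [score_dotProduct, sum_sum_eq_sum_objPair _ fun i => by simp]
  refine Finset.sum_congr rfl fun e _ => ?_
  rw [sigmoid_sub_swap (b e.1.1) (b e.1.2), comparisonMatrix_apply]
  push_cast
  ring

theorem numComparisons_eq_sum {n : ℕ} {w : Matrix (Fin n) (Fin n) ℕ} (hw : ∀ i, w i i = 0) :
    numComparisons w = ∑ i, ∑ j, w i j := by
  rw [sum_sum_eq_sum_objPair (fun i j => w i j) hw, numComparisons,
      sum_Ioi_eq_sum_objPair (comparisonMatrix w)]
  rfl

/-- Supplies the identically distributed dominating variables of the central limit theorem, since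
the scores of different subjects need not share a law. -/
theorem abs_score_dotProduct_le {n : ℕ} {w : Matrix (Fin n) (Fin n) ℕ} (hw : ∀ i, w i i = 0)
    (b : EuclideanSpace ℝ (Fin n)) (t : Fin n → ℝ) :
    |score w b ⬝ᵥ t| ≤ (∑ i, ∑ j, |t i - t j|) * (numComparisons w : ℝ) := by
  rw [score_dotProduct, numComparisons_eq_sum hw]
  push_cast
  rw [Finset.mul_sum]
  refine (Finset.abs_sum_le_sum_abs _ _).trans (Finset.sum_le_sum fun i _ => ?_)
  rw [Finset.mul_sum]
  refine (Finset.abs_sum_le_sum_abs _ _).trans (Finset.sum_le_sum fun j _ => ?_)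
  rw [abs_mul, abs_mul, Nat.abs_cast, abs_of_pos (Real.sigmoid_pos _)]
  have h1 : |t i - t j| ≤ ∑ i, ∑ j, |t i - t j| :=
    (Finset.single_le_sum (f := fun j => |t i - t j|) (fun j _ => abs_nonneg _)
      (Finset.mem_univ j)).trans
      (Finset.single_le_sum (f := fun i => ∑ j, |t i - t j|)
        (fun i _ => Finset.sum_nonneg fun j _ => abs_nonneg _) (Finset.mem_univ i))
  calc (w i j : ℝ) * Real.sigmoid (b j - b i) * |t i - t j|
      ≤ (w i j : ℝ) * 1 * ∑ i, ∑ j, |t i - t j| := by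
        gcongr
        exact Real.sigmoid_le_one _
    _ = _ := by ring

theorem comparisonMatrix_le_numComparisons {n : ℕ} {w : Matrix (Fin n) (Fin n) ℕ}
    (hw : ∀ i, w i i = 0) (i j : Fin n) : comparisonMatrix w i j ≤ numComparisons w := by
  have key : ∀ e : ObjPair n, comparisonMatrix w e.1.1 e.1.2 ≤ numComparisons w := fun e => by
    rw [numComparisons,
      sum_Ioi_eq_sum_objPair (comparisonMatrix w)]
    exact Finset.single_le_sum (f := fun e : ObjPair n => comparisonMatrix w e.1.1 e.1.2)
      (fun _ _ => Nat.zero_le _) (Finset.mem_univ e)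
  rcases lt_trichotomy i j with h | h | h
  · exact key ⟨(i, j), h⟩
  · subst h
    simp [comparisonMatrix_apply, hw]
  · have := key ⟨(j, i), h⟩
    rw [comparisonMatrix_apply] at this ⊢
    simp only at this
    omega

theorem sum_objPair_winVar {n : ℕ} {v : Fin n → Fin n → ℝ} (hv : ∀ i j, v i j = v j i)
    (b : EuclideanSpace ℝ (Fin n)) (t : Fin n → ℝ) :
    ∑ e : ObjPair n, v e.1.1 e.1.2 * winVar b e.1.1 e.1.2 * (t e.1.1 - t e.1.2) ^ 2 =
      t ⬝ᵥ (laplacian fun i j => v i j * winVar b i j).mulVec t := by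
  rw [dotProduct_laplacian_mulVec, sum_sum_eq_sum_objPair _ fun i => by simp, Finset.mul_sum]
  refine Finset.sum_congr rfl fun e _ => ?_
  rw [hv e.1.2, winVar_comm b e.1.2]
  ring

theorem comparisonMatrix_comm {n : ℕ} (w : Matrix (Fin n) (Fin n) ℕ) (i j : Fin n) :
    comparisonMatrix w i j = comparisonMatrix w j i := by
  rw [comparisonMatrix_apply, comparisonMatrix_apply, add_comm]

/-! ### Integration over the fibers of a discrete statistic -/

/-- Countably many fibers partition the space, so conditioning on the comparison matrix needs only
elementary integrals over its level sets. -/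
theorem integral_eq_of_setIntegral_fiber_eq {Ω β : Type*} [MeasurableSpace Ω] {μ : Measure Ω}
    [Countable β] [MeasurableSpace β] [DiscreteMeasurableSpace β] {T : Ω → β}
    (hT : Measurable T) {f g : Ω → ℝ} (hf : Integrable f μ) (hg : Integrable g μ)
    (h : ∀ v, ∫ ω in T ⁻¹' {v}, f ω ∂μ = ∫ ω in T ⁻¹' {v}, g ω ∂μ) :
    ∫ ω, f ω ∂μ = ∫ ω, g ω ∂μ := by
  have hU : ⋃ v, T ⁻¹' {v} = Set.univ := by ext; simp
  have hm : ∀ v, MeasurableSet (T ⁻¹' {v}) := fun v => hT (MeasurableSet.of_discrete)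
  have hd : Pairwise (Function.onFun Disjoint fun v => T ⁻¹' {v}) := fun v v' hv =>
    Disjoint.preimage _ (by simpa using hv)
  have h1 := hasSum_integral_iUnion hm hd hf.integrableOn
  have h2 := hasSum_integral_iUnion hm hd hg.integrableOn
  rw [hU, setIntegral_univ] at h1 h2
  simp only [h] at h1
  exact h1.unique h2

/-! ### Moments of the comparison counts and of the score of one subject -/

section Survey

variable {n : ℕ} {Ω : Type*} [MeasurableSpace Ω] {μ : Measure Ω}
  {W : ℕ → Ω → Matrix (Fin n) (Fin n) ℕ} {P : Matrix (Fin n) (Fin n) ℝ}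
  {b : EuclideanSpace ℝ (Fin n)}

theorem IsSurvey.measurable_comp {β : Type*} [MeasurableSpace β] (hW : IsSurvey μ W P b) (s : ℕ)
    (f : Matrix (Fin n) (Fin n) ℕ → β) : Measurable fun ω => f (W s ω) :=
  (measurable_of_countable f).comp (hW.measurable s)

/-- The conditional law of the outcomes given the comparison matrix. -/
theorem IsSurvey.setIntegral_comparisonMatrix_eq [IsProbabilityMeasure μ]
    (hW : IsSurvey μ W P b) (s : ℕ)
    (h : Matrix (Fin n) (Fin n) ℕ → ℝ) {w : Matrix (Fin n) (Fin n) ℕ} (hw : ∀ i, w i i = 0) :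
    ∫ ω in (fun ω => comparisonMatrix (W s ω)) ⁻¹' {comparisonMatrix w}, h (W s ω) ∂μ =
      μ.real {ω | comparisonMatrix (W s ω) = comparisonMatrix w} *
        ∑ k ∈ Fintype.piFinset fun e : ObjPair n =>
            Finset.range (comparisonMatrix w e.1.1 e.1.2 + 1),
          (∏ e : ObjPair n, binomialWeight (comparisonMatrix w e.1.1 e.1.2)
            (Real.sigmoid (b e.1.1 - b e.1.2)) (k e)) * h (ofWins (comparisonMatrix w) k) := by
  classical
  set v := comparisonMatrix w with hv
  set K := Fintype.piFinset fun e : ObjPair n => Finset.range (v e.1.1 e.1.2 + 1) with hK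
  have hmem : ∀ k, k ∈ K ↔ ∀ e, k e ≤ v e.1.1 e.1.2 := by
    intro k
    simp [hK]
  -- A fiber is a finite disjoint union of events, one for each admissible vector of win counts;
  -- `outcome_law` gives the probability of each.
  have hset : (fun ω => comparisonMatrix (W s ω)) ⁻¹' {v} =
      ⋃ k ∈ K, {ω | W s ω = ofWins v k} := by
    ext ω
    simp only [Set.mem_preimage, Set.mem_singleton_iff, Set.mem_iUnion, Set.mem_ofPred_eq,
      exists_prop]
    constructor
    · intro hω
      refine ⟨fun e => W s ω e.1.1 e.1.2, (hmem _).2 fun e => ?_, ?_⟩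
      · rw [← hω, comparisonMatrix_apply]
        exact Nat.le_add_right _ _
      · rw [← hω, ofWins_comparisonMatrix (hW.diag_eq_zero s ω)]
    · rintro ⟨k, hk, hω⟩
      rw [hω, comparisonMatrix_ofWins hw ((hmem k).1 hk)]
  have hmeas : ∀ k, MeasurableSet {ω | W s ω = ofWins v k} := fun k =>
    hW.measurable s (MeasurableSet.of_discrete (s := {ofWins v k}))
  have hdisj : (K : Set (ObjPair n → ℕ)).PairwiseDisjoint
      fun k => {ω | W s ω = ofWins v k} := by
    intro k _ k' _ hkk'
    refine Set.disjoint_left.2 fun ω hω hω' => hkk' ?_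
    simp only [Set.mem_ofPred_eq] at hω hω'
    ext e
    rw [← ofWins_lt v k e, ← ofWins_lt v k' e, ← hω, ← hω']
  have hconst : ∀ k, ∀ ω ∈ {ω | W s ω = ofWins v k}, h (W s ω) = h (ofWins v k) := by
    intro k ω hω
    rw [hω]
  rw [hset, integral_biUnion_finset _ (fun k _ => hmeas k) hdisj, Finset.mul_sum]
  · refine Finset.sum_congr rfl fun k hk => ?_
    rw [setIntegral_congr_fun (hmeas k) (hconst k), setIntegral_const, hW.outcome_law s,
      comparisonMatrix_ofWins hw ((hmem k).1 hk), outcomeProb_ofWins b hw ((hmem k).1 hk),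
      smul_eq_mul, mul_assoc]
  · intro k _
    exact (integrableOn_const (C := h (ofWins v k))).congr_fun
      (fun ω hω => (hconst k ω hω).symm) (hmeas k)

theorem IsSurvey.identDistrib_numComparisons (hW : IsSurvey μ W P b) (s : ℕ) :
    IdentDistrib (fun ω => (numComparisons (W s ω) : ℝ)) (fun ω => (numComparisons (W 0 ω) : ℝ))
      μ μ :=
  (hW.identDistrib s).comp (u := fun m : ℕ => (m : ℝ)) (measurable_of_countable _)

theorem IsSurvey.memLp_numComparisons (hW : IsSurvey μ W P b) (s : ℕ) :
    MemLp (fun ω => (numComparisons (W s ω) : ℝ)) 2 μ :=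
  (hW.identDistrib_numComparisons s).symm.memLp_snd hW.memLp

theorem IsSurvey.memLp_score [IsProbabilityMeasure μ]
    (hW : IsSurvey μ W P b) (s : ℕ) (t : Fin n → ℝ) :
    MemLp (fun ω => score (W s ω) b ⬝ᵥ t) 2 μ := by
  refine ((hW.memLp_numComparisons s).const_mul (∑ i, ∑ j, |t i - t j|)).mono
    (hW.measurable_comp s fun w => score w b ⬝ᵥ t).aestronglyMeasurable
    (Eventually.of_forall fun ω => ?_)
  rw [Real.norm_eq_abs, Real.norm_eq_abs]
  exact (abs_score_dotProduct_le (hW.diag_eq_zero s ω) b t).trans (le_abs_self _)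

theorem IsSurvey.memLp_comparisonMatrix [IsProbabilityMeasure μ]
    (hW : IsSurvey μ W P b) (s : ℕ) (i j : Fin n) :
    MemLp (fun ω => (comparisonMatrix (W s ω) i j : ℝ)) 2 μ := by
  refine (hW.memLp_numComparisons s).mono
    (hW.measurable_comp s fun w => (comparisonMatrix w i j : ℝ)).aestronglyMeasurable
    (Eventually.of_forall fun ω => ?_)
  rw [Real.norm_natCast, Real.norm_natCast]
  exact_mod_cast comparisonMatrix_le_numComparisons (hW.diag_eq_zero s ω) i j

/-- Averaging the conditional expectation removes the dependence on the subject: only the mean of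
the total enters. -/
theorem IsSurvey.integral_comparisonMatrix [IsProbabilityMeasure μ]
    (hW : IsSurvey μ W P b) (s : ℕ) (i j : Fin n) :
    ∫ ω, (comparisonMatrix (W s ω) i j : ℝ) ∂μ =
      (∫ ω, (numComparisons (W 0 ω) : ℝ) ∂μ) * P i j := by
  have hle : MeasurableSpace.comap (fun ω => numComparisons (W s ω)) inferInstance ≤
      (inferInstance : MeasurableSpace Ω) :=
    (hW.measurable_comp s numComparisons).comap_le
  rw [← integral_condExp hle, integral_congr_ae (hW.condExp_eq s i j), integral_mul_const,
    (hW.identDistrib_numComparisons s).integral_eq]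

/-- Symmetry of `P` is not among the assumptions; it comes from symmetric counts and division by the
positive mean. -/
theorem IsSurvey.freq_comm [IsProbabilityMeasure μ]
    (hW : IsSurvey μ W P b) (i j : Fin n) : P i j = P j i := by
  have h1 := hW.integral_comparisonMatrix 0 i j
  have h2 := hW.integral_comparisonMatrix 0 j i
  simp only [comparisonMatrix_comm _ j i] at h2
  exact mul_left_cancel₀ hW.mean_pos.ne' (h1.symm.trans h2)

theorem IsSurvey.comparisonMatrix_ae_eq_zero [IsProbabilityMeasure μ]
    (hW : IsSurvey μ W P b) (s : ℕ) {i j : Fin n}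
    (hP : P i j = 0) : ∀ᵐ ω ∂μ, comparisonMatrix (W s ω) i j = 0 := by
  have h := hW.integral_comparisonMatrix s i j
  rw [hP, mul_zero, integral_eq_zero_iff_of_nonneg (fun ω => Nat.cast_nonneg _)
    ((hW.memLp_comparisonMatrix s i j).integrable (by norm_num))] at h
  filter_upwards [h] with ω hω
  simpa using hω

theorem setIntegral_fiber_of_isEmpty {β : Type*} {T : Ω → β} {v : β} (h : ¬ ∃ ω, T ω = v)
    (f : Ω → ℝ) : ∫ ω in T ⁻¹' {v}, f ω ∂μ = 0 := by
  have : T ⁻¹' {v} = ∅ := by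
    ext ω
    simpa using fun hω => h ⟨ω, hω⟩
  simp [this]

theorem score_ofWins_dotProduct {w : Matrix (Fin n) (Fin n) ℕ} (hw : ∀ i, w i i = 0)
    {k : ObjPair n → ℕ} (hk : ∀ e, k e ≤ comparisonMatrix w e.1.1 e.1.2) (t : Fin n → ℝ) :
    score (ofWins (comparisonMatrix w) k) b ⬝ᵥ t = ∑ e : ObjPair n, (t e.1.1 - t e.1.2) *
      ((k e : ℝ) - (comparisonMatrix w e.1.1 e.1.2 : ℝ) *
        Real.sigmoid (b e.1.1 - b e.1.2)) := by
  rw [score_dotProduct_eq_sum_objPair, comparisonMatrix_ofWins hw hk]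
  exact Finset.sum_congr rfl fun e _ => by rw [ofWins_lt]

theorem IsSurvey.integral_score [IsProbabilityMeasure μ]
    (hW : IsSurvey μ W P b) (s : ℕ) (t : Fin n → ℝ) :
    ∫ ω, score (W s ω) b ⬝ᵥ t ∂μ = 0 := by
  rw [← integral_zero Ω ℝ (μ := μ)]
  refine integral_eq_of_setIntegral_fiber_eq (hW.measurable_comp s comparisonMatrix)
    ((hW.memLp_score s t).integrable (by norm_num)) (integrable_zero _ _ _) fun v => ?_
  -- The conditional law is available only at comparison matrices of data with zero diagonal, which
  -- every attained value is.
  by_cases hv : ∃ ω, comparisonMatrix (W s ω) = v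
  · obtain ⟨ω₀, rfl⟩ := hv
    have hw := hW.diag_eq_zero s ω₀
    rw [hW.setIntegral_comparisonMatrix_eq s (fun w => score w b ⬝ᵥ t) hw]
    rw [Finset.sum_congr rfl fun k hk => by
      rw [score_ofWins_dotProduct hw
        (fun e => Nat.lt_succ_iff.1 (Finset.mem_range.1 (Fintype.mem_piFinset.1 hk e)))]]
    rw [sum_piFinset_prod_mul_sum
      (p := fun e : ObjPair n => binomialWeight (comparisonMatrix (W s ω₀) e.1.1 e.1.2)
        (Real.sigmoid (b e.1.1 - b e.1.2)))
      (x := fun (e : ObjPair n) k => (t e.1.1 - t e.1.2) * ((k : ℝ) -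
        (comparisonMatrix (W s ω₀) e.1.1 e.1.2 : ℝ) * Real.sigmoid (b e.1.1 - b e.1.2)))
      fun e => ?_]
    · simp
    · have := sum_binomialWeight_mul (comparisonMatrix (W s ω₀) e.1.1 e.1.2)
        (Real.sigmoid (b e.1.1 - b e.1.2))
      rw [← mul_zero (t e.1.1 - t e.1.2), ← this, Finset.mul_sum]
      exact Finset.sum_congr rfl fun k _ => by ring
  · rw [setIntegral_fiber_of_isEmpty hv, setIntegral_fiber_of_isEmpty hv]

/-- Given the comparison matrix, different pairs are uncorrelated and each contributes its binomial
variance, linear in its count. Averaging the counts produces the Fisher information, with the same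
value for every subject. -/
theorem IsSurvey.integral_score_sq [IsProbabilityMeasure μ]
    (hW : IsSurvey μ W P b) (s : ℕ) (t : Fin n → ℝ) :
    ∫ ω, (score (W s ω) b ⬝ᵥ t) ^ 2 ∂μ =
      (∫ ω, (numComparisons (W 0 ω) : ℝ) ∂μ) * (t ⬝ᵥ (fisherInfo P b).mulVec t) := by
  have hint : ∀ e : ObjPair n, Integrable (fun ω => (comparisonMatrix (W s ω) e.1.1 e.1.2 : ℝ) *
      winVar b e.1.1 e.1.2 * (t e.1.1 - t e.1.2) ^ 2) μ := fun e =>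
    (((hW.memLp_comparisonMatrix s _ _).integrable (by norm_num)).mul_const _).mul_const _
  have h1 : ∫ ω, (score (W s ω) b ⬝ᵥ t) ^ 2 ∂μ =
      ∫ ω, ∑ e : ObjPair n, (comparisonMatrix (W s ω) e.1.1 e.1.2 : ℝ) *
        winVar b e.1.1 e.1.2 * (t e.1.1 - t e.1.2) ^ 2 ∂μ := by
    refine integral_eq_of_setIntegral_fiber_eq (hW.measurable_comp s comparisonMatrix)
      (hW.memLp_score s t).integrable_sq (integrable_finsetSum _ fun e _ => hint e) fun v => ?_
    by_cases hv : ∃ ω, comparisonMatrix (W s ω) = v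
    · obtain ⟨ω₀, rfl⟩ := hv
      have hw := hW.diag_eq_zero s ω₀
      have hm : MeasurableSet ((fun ω => comparisonMatrix (W s ω)) ⁻¹'
          {comparisonMatrix (W s ω₀)}) :=
        hW.measurable_comp s comparisonMatrix MeasurableSet.of_discrete
      have hc : ∀ ω ∈ (fun ω => comparisonMatrix (W s ω)) ⁻¹' {comparisonMatrix (W s ω₀)},
          ∑ e : ObjPair n, (comparisonMatrix (W s ω) e.1.1 e.1.2 : ℝ) *
            winVar b e.1.1 e.1.2 * (t e.1.1 - t e.1.2) ^ 2 =
          ∑ e : ObjPair n, (comparisonMatrix (W s ω₀) e.1.1 e.1.2 : ℝ) *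
            winVar b e.1.1 e.1.2 * (t e.1.1 - t e.1.2) ^ 2 := by
        intro ω hω
        have hω' : comparisonMatrix (W s ω) = comparisonMatrix (W s ω₀) := hω
        rw [hω']
      rw [setIntegral_congr_fun hm hc, setIntegral_const, smul_eq_mul,
        hW.setIntegral_comparisonMatrix_eq s (fun w => (score w b ⬝ᵥ t) ^ 2) hw]
      rw [Finset.sum_congr rfl fun k hk => by
        rw [score_ofWins_dotProduct hw
          (fun e => Nat.lt_succ_iff.1 (Finset.mem_range.1 (Fintype.mem_piFinset.1 hk e)))]]
      rw [sum_piFinset_prod_mul_sum_sq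
        (p := fun e : ObjPair n => binomialWeight (comparisonMatrix (W s ω₀) e.1.1 e.1.2)
          (Real.sigmoid (b e.1.1 - b e.1.2)))
        (x := fun (e : ObjPair n) k => (t e.1.1 - t e.1.2) * ((k : ℝ) -
          (comparisonMatrix (W s ω₀) e.1.1 e.1.2 : ℝ) * Real.sigmoid (b e.1.1 - b e.1.2)))
        (τ := fun e : ObjPair n => (comparisonMatrix (W s ω₀) e.1.1 e.1.2 : ℝ) *
            winVar b e.1.1 e.1.2 * (t e.1.1 - t e.1.2) ^ 2)
        (fun e => sum_binomialWeight _ _) (fun e => ?_) fun e => ?_]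
      · rfl
      · have := sum_binomialWeight_mul (comparisonMatrix (W s ω₀) e.1.1 e.1.2)
          (Real.sigmoid (b e.1.1 - b e.1.2))
        rw [← mul_zero (t e.1.1 - t e.1.2), ← this, Finset.mul_sum]
        exact Finset.sum_congr rfl fun k _ => by ring
      · have := sum_binomialWeight_mul_sq (comparisonMatrix (W s ω₀) e.1.1 e.1.2)
          (Real.sigmoid (b e.1.1 - b e.1.2))
        rw [winVar, sigmoid_sub_swap (b e.1.1) (b e.1.2), ← this, Finset.sum_mul]
        exact Finset.sum_congr rfl fun k _ => by ring
    · rw [setIntegral_fiber_of_isEmpty hv, setIntegral_fiber_of_isEmpty hv]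
  rw [h1, integral_finsetSum _ fun e _ => hint e, fisherInfo_eq hW.freq_comm,
    ← sum_objPair_winVar hW.freq_comm, Finset.mul_sum]
  refine Finset.sum_congr rfl fun e _ => ?_
  rw [integral_mul_const, integral_mul_const, hW.integral_comparisonMatrix]
  ring

end Survey

/-! ### Pooled data -/

section Pooled

variable {n : ℕ} {Ω : Type*} {W : ℕ → Ω → Matrix (Fin n) (Fin n) ℕ}

theorem pooled_apply (S : ℕ) (ω : Ω) (i j : Fin n) :
    pooled W S ω i j = ∑ s ∈ Finset.range S, W s ω i j := by
  rw [pooled, Matrix.sum_apply]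

theorem comparisonMatrix_pooled (S : ℕ) (ω : Ω) (i j : Fin n) :
    comparisonMatrix (pooled W S ω) i j =
      ∑ s ∈ Finset.range S, comparisonMatrix (W s ω) i j := by
  simp only [comparisonMatrix_apply, pooled_apply, Finset.sum_add_distrib]

theorem numComparisons_pooled (S : ℕ) (ω : Ω) :
    numComparisons (pooled W S ω) = ∑ s ∈ Finset.range S, numComparisons (W s ω) := by
  simp only [numComparisons, comparisonMatrix_pooled]
  rw [Finset.sum_comm (s := Finset.range S)]
  exact Finset.sum_congr rfl fun i _ => Finset.sum_comm

theorem score_pooled (S : ℕ) (ω : Ω) (b : EuclideanSpace ℝ (Fin n)) (t : Fin n → ℝ) :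
    score (pooled W S ω) b ⬝ᵥ t = ∑ s ∈ Finset.range S, score (W s ω) b ⬝ᵥ t := by
  simp only [score_dotProduct, pooled_apply, Nat.cast_sum, Finset.sum_mul]
  rw [Finset.sum_comm (s := Finset.range S)]
  exact Finset.sum_congr rfl fun i _ => Finset.sum_comm

end Pooled

/-! ### Limit theorems for the pooled survey -/

section Survey

variable {n : ℕ} {Ω : Type*} [MeasurableSpace Ω] {μ : Measure Ω}
  {W : ℕ → Ω → Matrix (Fin n) (Fin n) ℕ} {P : Matrix (Fin n) (Fin n) ℝ}
  {b : EuclideanSpace ℝ (Fin n)}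

theorem IsSurvey.iIndepFun_comp (hW : IsSurvey μ W P b) (f : Matrix (Fin n) (Fin n) ℕ → ℝ) :
    iIndepFun (fun s ω => f (W s ω)) μ :=
  hW.indep.comp (fun _ => f) fun _ => measurable_of_countable f

theorem IsSurvey.measurable_pooled (hW : IsSurvey μ W P b) (S : ℕ) : Measurable (pooled W S) := by
  induction S with
  | zero =>
    have : pooled W 0 = fun _ => 0 := by
      funext ω
      simp [pooled]
    rw [this]
    exact measurable_const
  | succ S ih =>
    have : pooled W (S + 1) = (fun q : Matrix (Fin n) (Fin n) ℕ × Matrix (Fin n) (Fin n) ℕ =>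
        q.1 + q.2) ∘ fun ω => (pooled W S ω, W S ω) := by
      funext ω
      simp [pooled, Finset.sum_range_succ]
    rw [this]
    exact (measurable_of_countable _).comp (ih.prodMk (hW.measurable S))

theorem IsSurvey.integral_numComparisons_sq (hW : IsSurvey μ W P b) (s : ℕ) :
    ∫ ω, (numComparisons (W s ω) : ℝ) ^ 2 ∂μ = ∫ ω, (numComparisons (W 0 ω) : ℝ) ^ 2 ∂μ :=
  ((hW.identDistrib_numComparisons s).comp (u := fun y : ℝ => y ^ 2) (by fun_prop)).integral_eq

variable [IsProbabilityMeasure μ]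

/-- The totals are independent and identically distributed, so the strong law gives growth at the
positive linear rate of their mean. -/
theorem IsSurvey.ae_tendsto_numComparisons (hW : IsSurvey μ W P b) :
    ∀ᵐ ω ∂μ, Tendsto (fun S => numComparisons (pooled W S ω)) atTop atTop := by
  have h := strong_law_ae_real (fun s ω => (numComparisons (W s ω) : ℝ))
    (hW.memLp.integrable (by norm_num))
    (fun i j hij => (hW.iIndepFun_comp fun w => (numComparisons w : ℝ)).indepFun hij)
    hW.identDistrib_numComparisons
  filter_upwards [h] with ω hω
  rw [← tendsto_natCast_atTop_iff (R := ℝ)]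
  have h1 := Tendsto.pos_mul_atTop hW.mean_pos hω tendsto_natCast_atTop_atTop
  refine h1.congr' ?_
  filter_upwards [eventually_gt_atTop 0] with S hS
  have : (S : ℝ) ≠ 0 := by positivity
  rw [div_mul_cancel₀ _ this, numComparisons_pooled]
  push_cast
  rfl

theorem IsSurvey.tendsto_numComparisons_div (hW : IsSurvey μ W P b) :
    Tendsto (fun x : ℕ × Ω => (numComparisons (pooled W x.1 x.2) : ℝ) / x.1) (probFilter μ)
      (𝓝 (∫ ω, (numComparisons (W 0 ω) : ℝ) ∂μ)) := by
  have h := tendsto_sum_div_probFilter (X := fun s ω => (numComparisons (W s ω) : ℝ))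
    (hW.iIndepFun_comp fun w => (numComparisons w : ℝ))
    hW.memLp_numComparisons (fun s => (hW.identDistrib_numComparisons s).integral_eq)
    fun s => (hW.integral_numComparisons_sq s).le
  refine h.congr fun x => ?_
  rw [numComparisons_pooled, Nat.cast_sum]

theorem IsSurvey.tendsto_comparisonMatrix_div (hW : IsSurvey μ W P b) (i j : Fin n) :
    Tendsto (fun x : ℕ × Ω => (comparisonMatrix (pooled W x.1 x.2) i j : ℝ) / x.1)
      (probFilter μ) (𝓝 ((∫ ω, (numComparisons (W 0 ω) : ℝ) ∂μ) * P i j)) := by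
  have hle : ∀ s, ∫ ω, (comparisonMatrix (W s ω) i j : ℝ) ^ 2 ∂μ ≤
      ∫ ω, (numComparisons (W 0 ω) : ℝ) ^ 2 ∂μ := by
    intro s
    rw [← hW.integral_numComparisons_sq s]
    refine integral_mono (hW.memLp_comparisonMatrix s i j).integrable_sq
      (hW.memLp_numComparisons s).integrable_sq fun ω => ?_
    have := comparisonMatrix_le_numComparisons (hW.diag_eq_zero s ω) i j
    simp only
    gcongr
  have h := tendsto_sum_div_probFilter (X := fun s ω => (comparisonMatrix (W s ω) i j : ℝ))
    (hW.iIndepFun_comp fun w => (comparisonMatrix w i j : ℝ))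
    (fun s => hW.memLp_comparisonMatrix s i j) (fun s => hW.integral_comparisonMatrix s i j) hle
  refine h.congr fun x => ?_
  rw [comparisonMatrix_pooled, Nat.cast_sum]

theorem score_dotProduct_single (w : Matrix (Fin n) (Fin n) ℕ) (k : Fin n) :
    score w b ⬝ᵥ Pi.single k 1 = score w b k := by
  simp

theorem IsSurvey.tendsto_score_div (hW : IsSurvey μ W P b) (k : Fin n) :
    Tendsto (fun x : ℕ × Ω => score (pooled W x.1 x.2) b k / x.1) (probFilter μ) (𝓝 0) := by
  have h := tendsto_sum_div_probFilter (X := fun s ω => score (W s ω) b ⬝ᵥ Pi.single k 1)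
    (hW.iIndepFun_comp fun w => score w b ⬝ᵥ Pi.single k 1)
    (fun s => hW.memLp_score s _) (fun s => hW.integral_score s _)
    fun s => (hW.integral_score_sq s _).le
  refine h.congr fun x => ?_
  rw [← score_pooled, score_dotProduct_single]

theorem IsSurvey.measure_score_div_sqrt_le (hW : IsSurvey μ W P b) (k : Fin n) {M : ℝ}
    (hM : 0 < M) (S : ℕ) :
    μ {ω | M ≤ |score (pooled W S ω) b k / √S|} ≤ ENNReal.ofReal
      (((∫ ω, (numComparisons (W 0 ω) : ℝ) ∂μ) *
        (Pi.single k 1 ⬝ᵥ (fisherInfo P b).mulVec (Pi.single k 1))) / M ^ 2) := by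
  rcases Nat.eq_zero_or_pos S with h | h
  -- For `S = 0` the quotient is zero by convention, so the event is empty.
  · subst h
    simp [hM.not_ge]
  have hS : (0 : ℝ) < S := by exact_mod_cast h
  have hsq : 0 < √(S : ℝ) := Real.sqrt_pos.2 hS
  have h1 := measure_le_abs_sum_le (hW.iIndepFun_comp fun w => score w b ⬝ᵥ Pi.single k 1)
    (fun s => hW.memLp_score s _) (fun s => hW.integral_score s _)
    (fun s => (hW.integral_score_sq s _).le) (mul_pos hM hsq) S
  refine (measure_mono fun ω hω => ?_).trans (h1.trans_eq ?_)
  · simp only [Set.mem_ofPred_eq] at hω ⊢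
    rw [abs_div, abs_of_pos hsq, le_div_iff₀ hsq] at hω
    rwa [mul_zero, sub_zero, ← score_pooled, score_dotProduct_single]
  · congr 1
    rw [mul_pow, Real.sq_sqrt hS.le]
    field_simp

/-- If the maximum likelihood estimate is unique with positive probability, then the graph of the
pairs of objects that may be compared is connected. -/
theorem IsSurvey.eq_zero_of_freq (hW : IsSurvey μ W P b)
    (hexists : ∃ S, 0 < μ {ω | ∃! c, IsSumMLE (pooled W S ω) c}) {x : Fin n → ℝ}
    (hx : ∑ i, x i = 0) (h : ∀ i j, P i j * (x i - x j) ^ 2 = 0) : x = 0 := by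
  by_contra hx0
  obtain ⟨S, hS⟩ := hexists
  have hae : ∀ᵐ ω ∂μ, ∀ s i j, P i j = 0 → comparisonMatrix (W s ω) i j = 0 := by
    rw [ae_all_iff]; intro s
    rw [ae_all_iff]; intro i
    rw [ae_all_iff]; intro j
    by_cases hP : P i j = 0
    · filter_upwards [hW.comparisonMatrix_ae_eq_zero s hP] with ω hω _ using hω
    · exact Eventually.of_forall fun ω hP' => absurd hP' hP
  have hnot : ∀ᵐ ω ∂μ, ω ∉ {ω | ∃! c, IsSumMLE (pooled W S ω) c} := by
    filter_upwards [hae] with ω hω hmem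
    obtain ⟨c, hc, huniq⟩ := hmem
    -- Pairs across which `x` varies have frequency zero and so are almost surely never compared.
    -- Moving along `x` therefore yields a second maximizer.
    have hlik : logLik (pooled W S ω) (c + WithLp.toLp 2 x) = logLik (pooled W S ω) c := by
      refine logLik_congr _ fun i j _ hij => ?_
      have hPij : P i j ≠ 0 := by
        intro hP
        refine hij ?_
        rw [pooled_apply]
        refine Finset.sum_eq_zero fun s _ => ?_
        have := hω s i j hP
        rw [comparisonMatrix_apply] at this
        omega
      have hxij : x i - x j = 0 := by simpa [hPij] using h i j
      simp only [WithLp.ofLp_add, Pi.add_apply]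
      linarith
    have h2 : IsSumMLE (pooled W S ω) (c + WithLp.toLp 2 x) := by
      refine ⟨?_, fun d hd => ?_⟩
      · simp [Finset.sum_add_distrib, hc.1, hx]
      · rw [hlik]
        exact hc.2 d hd
    have h3 := huniq _ h2
    rw [add_eq_left] at h3
    exact hx0 (by simpa using h3)
  exact hS.ne' (measure_eq_zero_iff_ae_notMem.2 hnot)

theorem dotProduct_mulVec_of_transpose_eq {A : Matrix (Fin n) (Fin n) ℝ} (hA : A.transpose = A)
    (x y : Fin n → ℝ) : x ⬝ᵥ A.mulVec y = A.mulVec x ⬝ᵥ y := by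
  rw [Matrix.dotProduct_mulVec, ← Matrix.mulVec_transpose, hA]

/-- The identity A† A A† = A† as quadratic forms: it computes the limiting covariance and shows that
it is positive semidefinite. -/
theorem pseudoinverse_mulVec_dotProduct {A : Matrix (Fin n) (Fin n) ℝ} (hA : A.transpose = A)
    (t : Fin n → ℝ) :
    (pseudoinverse A).mulVec t ⬝ᵥ A.mulVec ((pseudoinverse A).mulVec t) =
      t ⬝ᵥ (pseudoinverse A).mulVec t := by
  rw [← dotProduct_mulVec_of_transpose_eq (pseudoinverse_transpose hA), Matrix.mulVec_mulVec,
    Matrix.mulVec_mulVec, (isPseudoinverse_pseudoinverse A).mul_mul_right]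

theorem IsSurvey.fisherInfo_transpose (hW : IsSurvey μ W P b) :
    (fisherInfo P b).transpose = fisherInfo P b := by
  rw [fisherInfo_eq hW.freq_comm, laplacian_transpose]

theorem IsSurvey.posSemidef_pseudoinverse_fisherInfo (hW : IsSurvey μ W P b) :
    (pseudoinverse (fisherInfo P b)).PosSemidef := by
  refine Matrix.PosSemidef.of_dotProduct_mulVec_nonneg ?_ fun t => ?_
  · rw [Matrix.IsHermitian, Matrix.conjTranspose_eq_transpose_of_trivial,
      pseudoinverse_transpose hW.fisherInfo_transpose]
  · rw [star_trivial, ← pseudoinverse_mulVec_dotProduct hW.fisherInfo_transpose]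
    rw [fisherInfo_eq hW.freq_comm, dotProduct_laplacian_mulVec]
    refine mul_nonneg (by norm_num) (Finset.sum_nonneg fun i _ => Finset.sum_nonneg fun j _ => ?_)
    exact mul_nonneg (mul_nonneg (hW.freq_mem i j).1 (winVar_pos b i j).le) (sq_nonneg _)

/-- Asymptotic normality of the normalized score. -/
theorem IsSurvey.tendstoInDistribution_score (hW : IsSurvey μ W P b) {κ : ℝ}
    (hκ : κ = ∫ ω, (numComparisons (W 0 ω) : ℝ) ∂μ) :
    TendstoInDistribution
      (fun (S : ℕ) ω => WithLp.toLp 2 (((√κ)⁻¹ • pseudoinverse (fisherInfo P b)).mulVec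
        ((√(S : ℝ))⁻¹ • score (pooled W S ω) b)))
      atTop id (fun _ => μ) (multivariateGaussian 0 (pseudoinverse (fisherInfo P b))) where
  forall_aemeasurable S := by
    refine ((measurable_of_countable fun w => WithLp.toLp 2
      (((√κ)⁻¹ • pseudoinverse (fisherInfo P b)).mulVec ((√(S : ℝ))⁻¹ • score w b))).comp
        (hW.measurable_pooled S)).aemeasurable
  aemeasurable_limit := aemeasurable_id
  tendsto := by
    have hκpos : 0 < κ := hκ ▸ hW.mean_pos
    set J := pseudoinverse (fisherInfo P b) with hJ
    have hJt : J.transpose = J := pseudoinverse_transpose hW.fisherInfo_transpose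
    refine ProbabilityMeasure.tendsto_iff_tendsto_charFun.2 fun t => ?_
    have hG : charFun ((multivariateGaussian 0 J).map id) t =
        Complex.exp (-((t.ofLp ⬝ᵥ J.mulVec t.ofLp : ℝ) : ℂ) / 2) := by
      rw [Measure.map_id, charFun_multivariateGaussian hW.posSemidef_pseudoinverse_fisherInfo]
      congr 1
      simp
      ring
    simp only [ProbabilityMeasure.coe_mk]
    rw [hG]
    -- Moving the symmetric `J` onto the test vector reduces the multivariate limit to a scalar one
    -- in direction `u` (Cramér–Wold).
    set u : Fin n → ℝ := (√κ)⁻¹ • J.mulVec t.ofLp with hu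
    have hτ : κ * (u ⬝ᵥ (fisherInfo P b).mulVec u) = t.ofLp ⬝ᵥ J.mulVec t.ofLp := by
      rw [hu, Matrix.mulVec_smul, smul_dotProduct, dotProduct_smul,
        pseudoinverse_mulVec_dotProduct hW.fisherInfo_transpose, smul_eq_mul, smul_eq_mul,
        ← mul_assoc (√κ)⁻¹, ← mul_inv, Real.mul_self_sqrt hκpos.le, ← mul_assoc,
        mul_inv_cancel₀ hκpos.ne', one_mul]
    have hclt := tendsto_charFun_sum_of_dominated
      (hW.iIndepFun_comp fun w => score w b ⬝ᵥ u)
      (fun s => hW.measurable_comp s fun w => score w b ⬝ᵥ u)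
      (Y := fun s ω => (∑ i, ∑ j, |u i - u j|) * (numComparisons (W s ω) : ℝ))
      (hW.memLp.const_mul _)
      (fun s => (hW.identDistrib_numComparisons s).comp
        (u := fun y => (∑ i, ∑ j, |u i - u j|) * y) (by fun_prop))
      (fun s ω => abs_score_dotProduct_le (hW.diag_eq_zero s ω) b u)
      (fun s => hW.integral_score s u) (fun s => hW.integral_score_sq s u)
    rw [← hκ, hτ] at hclt
    refine hclt.congr fun S => ?_
    have hm : Measurable fun ω => ∑ s ∈ Finset.range S, score (W s ω) b ⬝ᵥ u :=
      Finset.measurable_fun_sum _ fun s _ => hW.measurable_comp s fun w => score w b ⬝ᵥ u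
    have hm' : Measurable fun ω => WithLp.toLp 2 (((√κ)⁻¹ • J).mulVec
        ((√(S : ℝ))⁻¹ • score (pooled W S ω) b)) :=
      (measurable_of_countable fun w => WithLp.toLp 2
        (((√κ)⁻¹ • J).mulVec ((√(S : ℝ))⁻¹ • score w b))).comp (hW.measurable_pooled S)
    rw [charFun_apply, charFun_apply, integral_map hm'.aemeasurable (by fun_prop),
      integral_map hm.aemeasurable (by fun_prop)]
    refine integral_congr_ae (Eventually.of_forall fun ω => ?_)
    simp only
    congr 3
    rw [← score_pooled, EuclideanSpace.inner_eq_star_dotProduct, star_trivial,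
      Matrix.smul_mulVec, Matrix.mulVec_smul, dotProduct_smul, dotProduct_smul,
      dotProduct_mulVec_of_transpose_eq hJt, dotProduct_smul, dotProduct_comm t.ofLp]
    simp only [smul_eq_mul, RCLike.inner_apply, conj_trivial]
    ring

end Survey

/-! ### Asymptotic normality and variance estimation -/

theorem theorem3p5 {n : ℕ} {Ω : Type*} [MeasurableSpace Ω]
    (μ : Measure Ω) [IsProbabilityMeasure μ]
    (W : ℕ → Ω → Matrix (Fin n) (Fin n) ℕ) (P : Matrix (Fin n) (Fin n) ℝ)
    (βstar : EuclideanSpace ℝ (Fin n)) (hβstar : ∑ i, βstar i = 0)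
    (hW : IsSurvey μ W P βstar)
    -- the MLE exists and is unique, with positive probability for some number of subjects
    (hexists : ∃ S, 0 < μ {ω | ∃! b, IsSumMLE (pooled W S ω) b})
    -- `βhat` is the MLE whenever the MLE exists and is unique
    (βhat : Matrix (Fin n) (Fin n) ℕ → EuclideanSpace ℝ (Fin n))
    (hβhat : ∀ w : Matrix (Fin n) (Fin n) ℕ, (∃! b, IsSumMLE w b) → IsSumMLE w (βhat w)) :
    (∀ᵐ ω ∂μ, Tendsto (fun S => numComparisons (pooled W S ω)) atTop atTop) ∧
    TendstoInDistribution
      (fun (S : ℕ) ω => √(numComparisons (pooled W S ω) : ℝ) •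
        (βhat (pooled W S ω) - βstar))
      atTop id (fun _ => μ)
      (multivariateGaussian 0 (pseudoinverse (fisherInfo P βstar))) ∧
    ∀ i j, TendstoInMeasure μ
      (fun (S : ℕ) ω => (numComparisons (pooled W S ω) : ℝ) *
        (-pseudoinverse (hessian (pooled W S ω) (βhat (pooled W S ω)))) i j)
      atTop (fun _ => pseudoinverse (fisherInfo P βstar) i j) := by
  obtain ⟨κ, hκ⟩ : ∃ κ, κ = ∫ ω, (numComparisons (W 0 ω) : ℝ) ∂μ := ⟨_, rfl⟩
  have hκpos : 0 < κ := hκ ▸ hW.mean_pos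
  -- The limit of minus the Hessian at β* per subject; the Fisher information is per comparison,
  -- hence the factor κ.
  set K := laplacian fun i j => κ * P i j * winVar βstar i j with hK
  have hKF : K = κ • fisherInfo P βstar := by
    rw [fisherInfo_eq hW.freq_comm, ← laplacian_smul, hK]
    simp only [mul_assoc]
  have hKinv : pseudoinverse K = κ⁻¹ • pseudoinverse (fisherInfo P βstar) := by
    rw [hKF, pseudoinverse_smul]
  have hA : ∀ x : Fin n → ℝ, x ≠ 0 → 0 < x ⬝ᵥ (K + avgMatrix n).mulVec x := by
    intro x hx
    refine dotProduct_laplacian_add_avgMatrix_pos (fun i j => ?_) (fun y hy h => ?_) hx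
    · exact mul_nonneg (mul_nonneg hκpos.le (hW.freq_mem i j).1) (winVar_pos βstar i j).le
    · refine hW.eq_zero_of_freq hexists hy fun i j => ?_
      have h1 := h i j
      have h2 := (winVar_pos βstar i j).ne'
      simpa [hκpos.ne', h2] using h1
  set l := probFilter μ with hl
  have hS : ∀ᶠ x : ℕ × Ω in l, 0 < (x.1 : ℝ) := by
    refine eventually_probFilter_fst (p := fun S => 0 < (S : ℝ)) ?_
    filter_upwards [eventually_gt_atTop 0] with S hS
    exact_mod_cast hS
  have hv : ∀ i j, Tendsto (fun x : ℕ × Ω =>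
      (comparisonMatrix (pooled W x.1 x.2) i j : ℝ) / x.1) l (𝓝 (κ * P i j)) := fun i j => by
    rw [hκ]
    exact hW.tendsto_comparisonMatrix_div i j
  have hN : Tendsto (fun x : ℕ × Ω => (numComparisons (pooled W x.1 x.2) : ℝ) / x.1) l
      (𝓝 κ) := by
    rw [hκ]
    exact hW.tendsto_numComparisons_div
  obtain ⟨hmle, hcons⟩ := eventually_isSumMLE hS hβstar hv hW.tendsto_score_div hA hβhat
  refine ⟨hW.ae_tendsto_numComparisons, ?_, fun i j => ?_⟩
  · obtain ⟨B, hB, hlin⟩ := exists_tendsto_linearization hS hβstar hv hA hcons hmle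
    -- Slutsky: it remains to show that the estimation error and the linear functional of the score
    -- differ by a term that vanishes in probability.
    refine tendstoInDistribution_of_tendstoInMeasure_sub _ _
      (hW.tendstoInDistribution_score hκ) ?_ fun S => ?_
    -- The coefficient matrices cancel in the limit because √κ κ⁻¹ = (√κ)⁻¹; they multiply S^(-1/2)
    -- times the score, which is bounded in probability.
    · have hD : Tendsto (fun x : ℕ × Ω =>
          √((numComparisons (pooled W x.1 x.2) : ℝ) / x.1) • B x -
            (√κ)⁻¹ • pseudoinverse (fisherInfo P βstar)) l (𝓝 0) := by
        have h1 := (((Real.continuous_sqrt.tendsto κ).comp hN).smul hB).sub_const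
          ((√κ)⁻¹ • pseudoinverse (fisherInfo P βstar))
        have h2 : √κ • pseudoinverse K - (√κ)⁻¹ • pseudoinverse (fisherInfo P βstar) = 0 := by
          have h3 : √κ * κ⁻¹ = (√κ)⁻¹ := by
            rw [← div_eq_mul_inv, Real.sqrt_div_self]
          rw [hKinv, smul_smul, h3, sub_self]
        rwa [h2] at h1
      have hcoord : ∀ k, Tendsto (fun x : ℕ × Ω => ∑ m,
          (√((numComparisons (pooled W x.1 x.2) : ℝ) / x.1) • B x -
            (√κ)⁻¹ • pseudoinverse (fisherInfo P βstar)) k m *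
          (score (pooled W x.1 x.2) βstar m / √(x.1 : ℝ))) l (𝓝 0) := by
        intro k
        rw [← Finset.sum_const_zero (s := (Finset.univ : Finset (Fin n)))]
        refine tendsto_finsetSum _ fun m _ => tendsto_mul_probFilter ?_
          fun M hM S => hW.measure_score_div_sqrt_le m hM S
        exact ((continuous_id.matrix_elem k m).tendsto
          (0 : Matrix (Fin n) (Fin n) ℝ)).comp hD
      have hvec := ((PiLp.continuous_toLp 2 fun _ : Fin n => ℝ).tendsto _).comp
        (tendsto_pi_nhds.2 hcoord)
      refine tendstoInMeasure_const_iff.2 (hvec.congr' ?_)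
      filter_upwards [hS, hlin] with x hSx hx
      have hsq : √(x.1 : ℝ) ≠ 0 := (Real.sqrt_pos.2 hSx).ne'
      ext k
      have hxk := congrFun hx k
      simp only [Matrix.mulVec, dotProduct, Pi.smul_apply, smul_eq_mul, WithLp.ofLp_sub,
        Pi.sub_apply] at hxk
      have e1 : βhat (pooled W x.1 x.2) k - βstar k =
          (x.1 : ℝ)⁻¹ * ∑ m, B x k m * score (pooled W x.1 x.2) βstar m := by
        rw [← hxk, inv_mul_cancel_left₀ hSx.ne']
      have e2 : (x.1 : ℝ)⁻¹ = (√(x.1 : ℝ))⁻¹ * (√(x.1 : ℝ))⁻¹ := by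
        rw [← mul_inv, Real.mul_self_sqrt hSx.le]
      simp only [Function.comp_apply, Matrix.sub_apply, Matrix.smul_apply, smul_eq_mul,
        Pi.sub_apply, WithLp.ofLp_sub, WithLp.ofLp_smul, Pi.smul_apply, Matrix.mulVec,
        dotProduct, e1, Real.sqrt_div' _ hSx.le]
      rw [e2, Finset.mul_sum, Finset.mul_sum, ← Finset.sum_sub_distrib]
      refine Finset.sum_congr rfl fun m _ => ?_
      field_simp
    · exact ((measurable_of_countable fun w => √(numComparisons w : ℝ) •
        (βhat w - βstar)).comp (hW.measurable_pooled S)).aemeasurable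
  · have h := tendsto_neg_pseudoinverse_hessian hS hv hA hcons hN
    rw [← hK, hKinv, smul_smul, mul_inv_cancel₀ hκpos.ne', one_smul] at h
    refine tendstoInMeasure_const_iff.2 ?_
    exact ((continuous_id.matrix_elem i j).tendsto _).comp h
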